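/- Let $m\ge 1$ and let $\boldsymbol z=(z_1,\dots,z_m)\in\mathbb R^m$ with $|z_i|\le 1$ for all $i$. Consider an $m$-class single-node service facility (any servers, any service times, any service discipline), described on a filtered probability space $(\Omega,(\mathcal F_t)_{t\ge0},\mathbb P)$ as follows. * *Arrivals.* Batches of customers arrive according to a batch Poisson process with rate $\lambda>0$ relative to $(\mathcal F_t)$: the arrival epochs $0<\tau_0<\tau_1<\cdots\to\infty$ form a Poisson process of rate $\lambda$; the batch compositions are i.i.d. copies of a random vector $\boldsymbol G=(G_1,\dots,G_m)\in\mathbb Z_+^m$ with $\mathbb E G_i<\infty$ ($G_i$ is the number of class-$i$ customers in a batch), and are independent of the arrival epochs; the arrivals (epochs and compositions) up to time $t$ are $\mathcal F_t$-measurable, and those after time $t$ are independent of $\mathcal F_t$. * *Queue lengths.* $\boldsymbol X(t)=(X_1(t),\dots,X_m(t))\in\mathbb Z_+^m$, where $X_i(t)$ is the number of class-$i$ customers in the system at time $t$, including those in service, is $\mathcal F_t$-measurable. No customer is lost, and a customer leaves immediately after completion of its service: $X_i(t)=X_i(0)+N^e_i(t)-N^d_i(t)$, where $N^e_i(t)$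 and $N^d_i(t)$ are the numbers of class-$i$ arrivals and departures in $(0,t]$, and $N^d_i$ is a right-continuous counting process. * *Individual service.* Almost surely, at each time at most one customer departs (in total over all classes), and no departure coincides with the arrival of a batch. The order of service is not specified. Assume that the steady-state distributions exist: there is a probability distribution $\pi$ on $\mathbb Z_+^m$ such that, almost surely, for every $\boldsymbol x$ the long-run fraction of time with $\boldsymbol X=\boldsymbol x$ is $\pi(\boldsymbol x)$; and for every $i$ with $\mathbb E G_i>0$ there is a probability distribution $\pi^d_i$ on $\mathbb Z_+^m$ such that, almost surely, for every $\boldsymbol x$ the long-run fraction of class-$i$ departures immediately after which $\boldsymbol X=\boldsymbol x$ is $\pi^d_i(\boldsymbol x)$. Let $L(\boldsymbol z)=\sum_{\boldsymbol x}\pi(\boldsymbol x)\,\boldsymbol z^{\boldsymbol x}$ and $S^c_i(\boldsymbol z)=\sum_{\boldsymbol x}\pi^d_i(\boldsymbol x)\,\boldsymbol z^{\boldsymbol x}$ be their probability generating functions, where $\boldsymbol z^{\boldsymbol x}=\prod_i z_i^{x_i}$ (if $\mathbb E G_i=0$, the $i$-th term below is $0$, whatever $S^c_i$ is). Then $$\bigl(1-\mathbb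 E[\boldsymbol z^{\boldsymbol G}]\bigr)\,L(\boldsymbol z)=\sum_{i=1}^m (1-z_i)\,\mathbb E[G_i]\,S^c_i(\boldsymbol z).$$ -/

import Mathlib

open MeasureTheory ProbabilityTheory Filter Topology
open scoped NNReal ENNReal

namespace BatchQueue

noncomputable section

variable {Ω : Type*} {m : ℕ}

/-- The probability generating function `z ↦ E[z₁ ^ Y₁ ⋯ z_m ^ Y_m]` of a probability distribution `p`
on `ℤ₊ ^ m`. The series converges absolutely whenever `|z i| ≤ 1` for all `i`. -/
def pgf (p : PMF (Fin m → ℕ)) (z : Fin m → ℝ) : ℝ :=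
  ∑' y : Fin m → ℕ, (p y).toReal * ∏ i, z i ^ y i

/-- The `i`-th coordinate of a `p`-distributed vector has a finite mean. -/
def HasFiniteMean (p : PMF (Fin m → ℕ)) (i : Fin m) : Prop :=
  Summable fun y : Fin m → ℕ => (p y).toReal * (y i : ℝ)

/-- The mean of the `i`-th coordinate of a `p`-distributed vector. -/
def mean (p : PMF (Fin m → ℕ)) (i : Fin m) : ℝ :=
  ∑' y : Fin m → ℕ, (p y).toReal * (y i : ℝ)

/-- The size `N(t) - N(t-)` of the jump at time `t` of a nondecreasing counting function `N`
(there is no jump at time `0`). -/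
def jump (N : ℝ≥0 → ℕ) (t : ℝ≥0) : ℕ :=
  N t - Function.leftLim N t

/-- The `(l + 1)`-st jump epoch of a right-continuous counting function `N` that starts at `0` and
has jumps of size one (a junk value if there are at most `l` jumps). -/
def jumpEpoch (N : ℝ≥0 → ℕ) (l : ℕ) : ℝ≥0 :=
  sInf {t : ℝ≥0 | l + 1 ≤ N t}

/-- The number of batches that arrive during the time interval `(s, t]`;
the `n`-th batch (`n = 0, 1, …`) arrives at time `τ n`. -/
def batchesIn (τ : ℕ → Ω → ℝ≥0) (s t : ℝ≥0) (ω : Ω) : ℕ :=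
  {n : ℕ | s < τ n ω ∧ τ n ω ≤ t}.ncard

/-- The number of batches of composition `g` that arrive during the time interval `(s, t]`;
the `n`-th batch contains `G n ω i` customers of class `i`. -/
def batchesOfTypeIn (τ : ℕ → Ω → ℝ≥0) (G : ℕ → Ω → Fin m → ℕ) (g : Fin m → ℕ)
    (s t : ℝ≥0) (ω : Ω) : ℕ :=
  {n : ℕ | s < τ n ω ∧ τ n ω ≤ t ∧ G n ω = g}.ncard

/-- The number of class-`i` customers that arrive during `(0, t]`. -/
def arrivals (τ : ℕ → Ω → ℝ≥0) (G : ℕ → Ω → Fin m → ℕ) (t : ℝ≥0) (ω : Ω) (i : Fin m) : ℕ :=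
  ∑ n ∈ Finset.range (batchesIn τ 0 t ω), G n ω i

/-- The information about the batches that arrive after time `t` (how many batches of which
composition arrive during `(t, u]`, for all `u`). -/
@[reducible] def futureArrivals (τ : ℕ → Ω → ℝ≥0) (G : ℕ → Ω → Fin m → ℕ) (t : ℝ≥0) : MeasurableSpace Ω :=
  ⨆ (u : ℝ≥0) (g : Fin m → ℕ), MeasurableSpace.comap (batchesOfTypeIn τ G g t u) ⊤

/-- Relative to the history `𝓕`, batches arrive according to a batch Poisson process of rate `lam`
whose batch compositions are i.i.d. with distribution `ν`. -/
structure IsBatchPoisson {mΩ : MeasurableSpace Ω} (P : Measure Ω) (𝓕 : Filtration ℝ≥0 mΩ)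
    (lam : ℝ≥0) (ν : PMF (Fin m → ℕ)) (τ : ℕ → Ω → ℝ≥0) (G : ℕ → Ω → Fin m → ℕ) : Prop where
  measurable_epoch : ∀ n, Measurable (τ n)
  measurable_batch : ∀ n, Measurable (G n)
  /-- The batches arrive at distinct positive epochs, finitely many in bounded time. -/
  epochs : ∀ᵐ ω ∂P, (∀ n, 0 < τ n ω) ∧ (StrictMono fun n => τ n ω) ∧
    Tendsto (fun n => τ n ω) atTop atTop
  /-- The number of batches in an interval has a Poisson distribution. -/
  poisson : ∀ s t : ℝ≥0, s ≤ t →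
    P.map (batchesIn τ s t) = poissonMeasure (lam * (t - s))
  /-- The compositions are i.i.d. with distribution `ν` and independent of the arrival epochs. -/
  batch_law : ∀ n, P.map (G n) = ν.toMeasure
  batch_indep : iIndepFun G P
  batch_indep_epochs : IndepFun (fun ω n => G n ω) (fun ω n => τ n ω) P
  /-- The arrivals up to time `t` belong to the history up to time `t`. -/
  adapted : ∀ (t : ℝ≥0) (g : Fin m → ℕ), Measurable[𝓕 t] (batchesOfTypeIn τ G g 0 t)
  /-- The arrivals after time `t` are independent of the history up to time `t`. -/
  indep_past : ∀ t : ℝ≥0, Indep (futureArrivals τ G t) (𝓕 t) P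

/-- An `m`-class single-node service facility fed by the batches `(τ, G)`: `X t ω i` is the
number of class-`i` customers in the system (including those in service) at time `t`, and `N i t ω` is
the number of class-`i` customers that have completed their service, and therefore left, during
`(0, t]`. Servers, service times and the service discipline (which may use the whole past and additional
randomness) are unrestricted; they act through the departure processes `N`. -/
structure IsFacility {mΩ : MeasurableSpace Ω} (P : Measure Ω) (𝓕 : Filtration ℝ≥0 mΩ)
    (τ : ℕ → Ω → ℝ≥0) (G : ℕ → Ω → Fin m → ℕ)
    (X : ℝ≥0 → Ω → Fin m → ℕ) (N : Fin m → ℝ≥0 → Ω → ℕ) : Prop where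
  /-- The queue lengths up to time `t` belong to the history up to time `t`. -/
  adapted : ∀ t, Measurable[𝓕 t] (X t)
  /-- The departure processes are counting processes. -/
  counting : ∀ᵐ ω ∂P, ∀ i, N i 0 ω = 0 ∧ (Monotone fun t => N i t ω) ∧
    ∀ t, ContinuousWithinAt (fun u => N i u ω) (Set.Ici t) t
  /-- No customer is lost, and customers leave only by completing their service. -/
  balance : ∀ᵐ ω ∂P, ∀ t i, X t ω i + N i t ω = X 0 ω i + arrivals τ G t ω i
  /-- Customers are served individually: there is at most one departure at a time. -/
  single : ∀ᵐ ω ∂P, ∀ t, ∑ i, jump (fun u => N i u ω) t ≤ 1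
  /-- Arrivals and departures do not occur simultaneously. -/
  no_coincidence : ∀ᵐ ω ∂P, ∀ n i, jump (fun u => N i u ω) (τ n ω) = 0

/-- `p` is the steady-state distribution of the queue lengths `X` (at an arbitrary time): almost surely,
for each `x` the long-run fraction of time during which `X = x` is `p x`. -/
def IsSteadyState {mΩ : MeasurableSpace Ω} (P : Measure Ω) (X : ℝ≥0 → Ω → Fin m → ℕ)
    (p : PMF (Fin m → ℕ)) : Prop :=
  ∀ᵐ ω ∂P, ∀ x : Fin m → ℕ,
    Tendsto (fun T : ℝ => T⁻¹ * ∫ s in (0 : ℝ)..T, if X s.toNNReal ω = x then (1 : ℝ) else 0)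
      atTop (𝓝 (p x).toReal)

/-- `p` is the steady-state distribution of the queue lengths `X` immediately after the jump
epochs of the counting process `N`: almost surely, for each `x` the long-run fraction of the jumps of `N`
immediately after which `X = x` is `p x`. -/
def IsSteadyStateAfterJumps {mΩ : MeasurableSpace Ω} (P : Measure Ω) (X : ℝ≥0 → Ω → Fin m → ℕ)
    (N : ℝ≥0 → Ω → ℕ) (p : PMF (Fin m → ℕ)) : Prop :=
  ∀ᵐ ω ∂P, ∀ x : Fin m → ℕ,
    Tendsto (fun n : ℕ => (n : ℝ)⁻¹ * ∑ l ∈ Finset.range n,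
        if X (jumpEpoch (fun u => N u ω) l) ω = x then (1 : ℝ) else 0)
      atTop (𝓝 (p x).toReal)

end

end BatchQueue

namespace BatchQueue

/-! ### Moments of the Poisson distribution -/

theorem hasSum_poisson_descFactorial (r : ℝ≥0) (k : ℕ) :
    HasSum (fun n : ℕ => Real.exp (-r) * (r : ℝ) ^ n / n.factorial * (n.descFactorial k : ℝ))
      ((r : ℝ) ^ k) := by
  have h := (hasSum_one_poissonMeasure r).mul_left ((r : ℝ) ^ k)
  rw [mul_one] at h
  have h0 : ∑ n ∈ Finset.range k,
      Real.exp (-r) * (r : ℝ) ^ n / n.factorial * (n.descFactorial k : ℝ) = 0 :=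
    Finset.sum_eq_zero fun n hn => by
      rw [Nat.descFactorial_of_lt (Finset.mem_range.1 hn)]; simp
  have h1 := (hasSum_nat_add_iff (f := fun n : ℕ =>
    Real.exp (-r) * (r : ℝ) ^ n / n.factorial * (n.descFactorial k : ℝ)) (g := (r : ℝ) ^ k) k).1
  rw [h0, add_zero] at h1
  refine h1 (h.congr_fun fun n => ?_)
  have h2 := Nat.factorial_mul_descFactorial (Nat.le_add_left k n)
  rw [Nat.add_sub_cancel] at h2
  rw [← h2, pow_add]
  have := n.factorial_pos
  have h3 : 0 < (n + k).descFactorial k := Nat.descFactorial_pos.2 (by omega)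
  push_cast
  field_simp

theorem hasSum_poisson_mean (r : ℝ≥0) :
    HasSum (fun n : ℕ => Real.exp (-r) * (r : ℝ) ^ n / n.factorial * (n : ℝ)) r := by
  simpa using hasSum_poisson_descFactorial r 1

theorem hasSum_poisson_sq (r : ℝ≥0) :
    HasSum (fun n : ℕ => Real.exp (-r) * (r : ℝ) ^ n / n.factorial * (n : ℝ) ^ 2)
      (r + (r : ℝ) ^ 2) := by
  refine ((hasSum_poisson_mean r).add (hasSum_poisson_descFactorial r 2)).congr_fun fun n => ?_
  rw [← mul_add]
  congr 1
  rcases n with _ | n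
  · simp
  · simp [Nat.descFactorial_succ]
    ring

theorem integrable_poisson_id (r : ℝ≥0) : Integrable (fun n : ℕ => (n : ℝ)) (poissonMeasure r) :=
  integrable_poissonMeasure_iff.2 (by simpa using (hasSum_poisson_mean r).summable)

theorem integrable_poisson_sq (r : ℝ≥0) :
    Integrable (fun n : ℕ => (n : ℝ) ^ 2) (poissonMeasure r) :=
  integrable_poissonMeasure_iff.2 (by simpa using (hasSum_poisson_sq r).summable)

theorem integral_poisson_id (r : ℝ≥0) : ∫ n : ℕ, (n : ℝ) ∂poissonMeasure r = r := by
  rw [integral_poissonMeasure]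
  exact (hasSum_poisson_mean r).tsum_eq

theorem integral_poisson_sq (r : ℝ≥0) :
    ∫ n : ℕ, (n : ℝ) ^ 2 ∂poissonMeasure r = r + (r : ℝ) ^ 2 := by
  rw [integral_poissonMeasure]
  exact (hasSum_poisson_sq r).tsum_eq

/-! ### Martingale transforms -/

/-- The second moment of a transform of bounded predictable weights against centred increments that
are independent of the past. -/
theorem integral_sq_transform_le {Ω : Type*} {mΩ : MeasurableSpace Ω} {P : Measure Ω}
    [IsProbabilityMeasure P] (F : ℕ → MeasurableSpace Ω) (hF : Monotone F) (hFle : ∀ j, F j ≤ mΩ)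
    (Z A : ℕ → Ω → ℝ) (hZ : ∀ j, Measurable[F j] (Z j)) (hZ1 : ∀ j ω, |Z j ω| ≤ 1)
    (hA : ∀ j, ∃ Y, Measurable[F (j + 1)] Y ∧ A j =ᵐ[P] Y)
    (hindep : ∀ j (Y : Ω → ℝ), Measurable[F j] Y → IndepFun Y (A j) P)
    (hL2 : ∀ j, MemLp (A j) 2 P) (hmean : ∀ j, ∫ ω, A j ω ∂P = 0) {v : ℝ}
    (hv : ∀ j, ∫ ω, A j ω ^ 2 ∂P ≤ v) (k : ℕ) :
    MemLp (fun ω => ∑ j ∈ Finset.range k, Z j ω * A j ω) 2 P ∧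
      ∫ ω, (∑ j ∈ Finset.range k, Z j ω * A j ω) ^ 2 ∂P ≤ k * v ∧
      ∃ Y, Measurable[F k] Y ∧ (fun ω => ∑ j ∈ Finset.range k, Z j ω * A j ω) =ᵐ[P] Y := by
  induction k with
  | zero => exact ⟨by simp, by simp, fun _ => 0, measurable_const, by simp⟩
  | succ k ih =>
    obtain ⟨hM, hle, Y, hY, hMY⟩ := ih
    have hZm : Measurable (Z k) := (hZ k).mono (hFle k) le_rfl
    have hZA : MemLp (fun ω => Z k ω * A k ω) 2 P := by
      refine (hL2 k).of_le (hZm.aestronglyMeasurable.mul (hL2 k).1) (ae_of_all _ fun ω => ?_)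
      rw [norm_mul]
      exact mul_le_of_le_one_left (norm_nonneg _) (hZ1 k ω)
    refine ⟨?_, ?_, ?_⟩
    · simp_rw [Finset.sum_range_succ]
      exact hM.add hZA
    · set M := fun ω => ∑ j ∈ Finset.range k, Z j ω * A j ω with hMdef
      have hexp : ∀ ω, (∑ j ∈ Finset.range (k + 1), Z j ω * A j ω) ^ 2 =
          M ω ^ 2 + 2 * (M ω * (Z k ω * A k ω)) + (Z k ω * A k ω) ^ 2 := fun ω => by
        rw [Finset.sum_range_succ]; simp only [hMdef]; ring
      have i1 : Integrable (fun ω => M ω ^ 2) P := hM.integrable_sq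
      have i2 : Integrable (fun ω => M ω * (Z k ω * A k ω)) P := hM.integrable_mul hZA
      have i3 : Integrable (fun ω => (Z k ω * A k ω) ^ 2) P := hZA.integrable_sq
      have hcross : ∫ ω, M ω * (Z k ω * A k ω) ∂P = 0 := by
        have e : (fun ω => M ω * (Z k ω * A k ω)) =ᵐ[P] fun ω => (Y ω * Z k ω) * A k ω := by
          filter_upwards [hMY] with ω h
          rw [h]; ring
        have hYZ : Measurable[F k] (fun ω => Y ω * Z k ω) := hY.mul (hZ k)
        rw [integral_congr_ae e, (hindep k _ hYZ).integral_fun_mul_eq_mul_integral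
          ((hYZ.mono (hFle k) le_rfl).aestronglyMeasurable) (hL2 k).1, hmean, mul_zero]
      have h3 : ∫ ω, (Z k ω * A k ω) ^ 2 ∂P ≤ v := by
        refine (integral_mono i3 (hL2 k).integrable_sq fun ω => ?_).trans (hv k)
        rw [mul_pow]
        exact mul_le_of_le_one_left (sq_nonneg _) ((sq_le_one_iff_abs_le_one _).2 (hZ1 k ω))
      have i12 : Integrable (fun ω => M ω ^ 2 + 2 * (M ω * (Z k ω * A k ω))) P :=
        i1.add (i2.const_mul 2)
      simp_rw [hexp]
      rw [integral_add i12 i3, integral_add i1 (i2.const_mul 2),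
        integral_const_mul, hcross]
      push_cast
      linarith
    · obtain ⟨B, hB, hAB⟩ := hA k
      refine ⟨fun ω => Y ω + Z k ω * B ω,
        (hY.mono (hF k.le_succ) le_rfl).add (((hZ k).mono (hF k.le_succ) le_rfl).mul hB), ?_⟩
      filter_upwards [hMY, hAB] with ω h1 h2
      rw [Finset.sum_range_succ, h1, h2]

/-! ### Convergence of averages -/

theorem hasSum_pmf_toReal {E : Type*} (p : PMF E) : HasSum (fun x => (p x).toReal) 1 := by
  have h := ENNReal.hasSum_toReal (f := fun x => p x) (by rw [p.tsum_coe]; simp)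
  rwa [← ENNReal.tsum_toReal_eq (fun x => p.apply_ne_top x), p.tsum_coe, ENNReal.toReal_one] at h

theorem exists_pos_pmf {E : Type*} (p : PMF E) : ∃ y, 0 < (p y).toReal := by
  obtain ⟨y, hy⟩ := p.support_nonempty
  exact ⟨y, ENNReal.toReal_pos ((p.mem_support_iff y).1 hy) (p.apply_ne_top y)⟩

theorem summable_pmf_mul {E : Type*} (p : PMF E) {f : E → ℝ} (hf : ∀ x, |f x| ≤ 1) :
    Summable fun x => (p x).toReal * f x :=
  Summable.of_norm_bounded (hasSum_pmf_toReal p).summable fun x => by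
    rw [norm_mul, Real.norm_of_nonneg ENNReal.toReal_nonneg]
    exact mul_le_of_le_one_right ENNReal.toReal_nonneg (hf x)

/-- Probability weights that converge pointwise to probability weights do so in total variation. -/
theorem tendsto_tsum_mul_of_tendsto_weights {E : Type*} (p : PMF E) (a : ℕ → E → ℝ)
    (ha0 : ∀ n x, 0 ≤ a n x) (ha1 : ∀ᶠ n in atTop, HasSum (a n) 1)
    (hlim : ∀ x, Tendsto (fun n => a n x) atTop (𝓝 (p x).toReal)) {f : E → ℝ}
    (hf : ∀ x, |f x| ≤ 1) :
    Tendsto (fun n => ∑' x, a n x * f x) atTop (𝓝 (∑' x, (p x).toReal * f x)) := by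
  have hp := hasSum_pmf_toReal p
  have h0 : Tendsto (fun n => ∑' x, max ((p x).toReal - a n x) 0) atTop (𝓝 0) := by
    have h := tendsto_tsum_of_dominated_convergence (𝓕 := atTop) (β := E)
      (f := fun n x => max ((p x).toReal - a n x) 0) (g := fun _ => (0 : ℝ)) hp.summable
      (fun x => by
        have h1 := ((tendsto_const_nhds (x := (p x).toReal)).sub (hlim x)).max
          (tendsto_const_nhds (x := (0 : ℝ)))
        simpa using h1)
      (Eventually.of_forall fun n x => by
        rw [Real.norm_of_nonneg (le_max_right _ _)]
        exact max_le (by linarith [ha0 n x]) ENNReal.toReal_nonneg)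
    simpa using h
  rw [tendsto_iff_norm_sub_tendsto_zero]
  refine squeeze_zero' (Eventually.of_forall fun _ => norm_nonneg _) ?_
    (by simpa using h0.const_mul 2)
  filter_upwards [ha1] with n h1
  have sa : Summable fun x => a n x * f x := by
    refine Summable.of_norm_bounded h1.summable fun x => ?_
    rw [norm_mul, Real.norm_of_nonneg (ha0 n x)]
    exact mul_le_of_le_one_right (ha0 n x) (hf x)
  have sm : Summable fun x => max ((p x).toReal - a n x) 0 := by
    refine Summable.of_nonneg_of_le (fun _ => le_max_right _ _) (fun x => ?_) hp.summable
    exact max_le (by linarith [ha0 n x]) ENNReal.toReal_nonneg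
  have hs := (h1.sub hp).add (sm.hasSum.mul_left 2)
  rw [sub_self, zero_add] at hs
  rw [← sa.tsum_sub (summable_pmf_mul p hf)]
  refine tsum_of_norm_bounded hs fun x => ?_
  rw [← sub_mul, norm_mul]
  refine (mul_le_of_le_one_right (norm_nonneg _) (hf x)).trans ?_
  rw [Real.norm_eq_abs]
  rcases le_total (a n x) (p x).toReal with h | h
  · rw [abs_of_nonpos (by linarith), max_eq_left (by linarith)]; linarith
  · rw [abs_of_nonneg (by linarith), max_eq_right (by linarith)]; linarith

theorem tendsto_integral_of_tendsto_singleton {E : Type*} [Countable E] [MeasurableSpace E]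
    [MeasurableSingletonClass E] (p : PMF E) (μ : ℕ → Measure E)
    (hμ : ∀ᶠ n in atTop, IsProbabilityMeasure (μ n))
    (hlim : ∀ x, Tendsto (fun n => (μ n).real {x}) atTop (𝓝 (p x).toReal)) {f : E → ℝ}
    (hf : ∀ x, |f x| ≤ 1) :
    Tendsto (fun n => ∫ x, f x ∂μ n) atTop (𝓝 (∑' x, (p x).toReal * f x)) := by
  refine (tendsto_tsum_mul_of_tendsto_weights p (fun n x => (μ n).real {x})
    (fun _ _ => measureReal_nonneg) ?_ hlim hf).congr' ?_
  · filter_upwards [hμ] with n hn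
    have h := hasSum_integral_iUnion (μ := μ n) (f := fun _ => (1 : ℝ)) (s := fun x : E => {x})
      (fun x => measurableSet_singleton x) (fun x y hxy => by simpa using hxy) (by simp)
    simpa [Set.iUnion_of_singleton, measureReal_def] using h
  · filter_upwards [hμ] with n hn
    have : Integrable f (μ n) := Integrable.of_bound (Measurable.of_discrete).aestronglyMeasurable 1
      (ae_of_all _ hf)
    rw [integral_countable this]
    rfl

/-! ### Riemann sums -/

theorem tendsto_riemann_sum {u : ℝ → ℝ} (hu : Measurable u) (hu1 : ∀ x, |u x| ≤ 1)
    (huc : ∀ᵐ x, ContinuousAt u x) {T : ℝ} (hT : 0 < T) :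
    Tendsto (fun k : ℕ => T / k * ∑ j ∈ Finset.range k, u (j * T / k)) atTop
      (𝓝 (∫ x in (0 : ℝ)..T, u x)) := by
  have hfloor : ∀ (k : ℕ) (x : ℝ), 0 < k → 0 ≤ x →
      x - T / k ≤ (⌊x * k / T⌋₊ : ℝ) * T / k ∧ (⌊x * k / T⌋₊ : ℝ) * T / k ≤ x := by
    intro k x hk hx
    have hk' : (0 : ℝ) < k := by exact_mod_cast hk
    have h1 := Nat.floor_le (a := x * k / T) (by positivity)
    have h2 := (Nat.lt_floor_add_one (x * k / T)).le
    rw [le_div_iff₀ hT] at h1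
    rw [div_le_iff₀ hT] at h2
    constructor
    · rw [le_div_iff₀ hk', sub_mul, div_mul_cancel₀ _ hk'.ne']; linarith
    · rw [div_le_iff₀ hk']; linarith
  have hlim : Tendsto (fun k : ℕ => ∫ x in (0 : ℝ)..T, u ((⌊x * k / T⌋₊ : ℝ) * T / k)) atTop
      (𝓝 (∫ x in (0 : ℝ)..T, u x)) := by
    refine intervalIntegral.tendsto_integral_filter_of_dominated_convergence (fun _ => 1) ?_ ?_ ?_ ?_
    · refine Eventually.of_forall fun k => Measurable.aestronglyMeasurable ?_
      refine hu.comp (Measurable.div_const (Measurable.mul_const ?_ _) _)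
      exact measurable_from_nat.comp (Nat.measurable_floor.comp (by fun_prop))
    · exact Eventually.of_forall fun k => ae_of_all _ fun x _ => hu1 _
    · simp
    · filter_upwards [huc] with x hx hxT
      rw [Set.uIoc_of_le hT.le] at hxT
      refine hx.tendsto.comp ?_
      refine tendsto_of_tendsto_of_tendsto_of_le_of_le' (g := fun k : ℕ => x - T / k) (h := fun _ => x)
        ?_ tendsto_const_nhds ?_ ?_
      · simpa using tendsto_const_nhds.sub (tendsto_const_div_atTop_nhds_zero_nat T)
      · filter_upwards [eventually_gt_atTop 0] with k hk using (hfloor k x hk hxT.1.le).1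
      · filter_upwards [eventually_gt_atTop 0] with k hk using (hfloor k x hk hxT.1.le).2
  refine hlim.congr' ?_
  filter_upwards [eventually_gt_atTop 0] with k hk
  have hk' : (0 : ℝ) < k := by exact_mod_cast hk
  have hpiece : ∀ j : ℕ, IntervalIntegrable (fun x => u ((⌊x * k / T⌋₊ : ℝ) * T / k)) volume
      (j * T / k) ((j + 1 : ℕ) * T / k) ∧
      ∫ x in (j * T / k : ℝ)..((j + 1 : ℕ) * T / k), u ((⌊x * k / T⌋₊ : ℝ) * T / k) =
        T / k * u (j * T / k) := by
    intro j
    have hle : (j * T / k : ℝ) ≤ (j + 1 : ℕ) * T / k := by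
      push_cast; gcongr; linarith
    have heq : Set.EqOn (fun x => u ((⌊x * k / T⌋₊ : ℝ) * T / k)) (fun _ => u (j * T / k))
        (Set.Ioo (j * T / k) ((j + 1 : ℕ) * T / k)) := by
      intro x hx
      have h1 : ⌊x * k / T⌋₊ = j := by
        have hx1 := hx.1; have hx2 := hx.2
        rw [div_lt_iff₀ hk'] at hx1
        rw [lt_div_iff₀ hk'] at hx2
        rw [Nat.floor_eq_iff (by
          have : (0 : ℝ) ≤ j * T := by positivity
          apply div_nonneg _ hT.le; linarith), le_div_iff₀ hT, div_lt_iff₀ hT]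
        push_cast at hx2
        exact ⟨hx1.le, hx2⟩
      simp only [h1]
    constructor
    · rw [intervalIntegrable_iff_integrableOn_Ioo_of_le hle]
      exact (integrableOn_const (by simp)).congr_fun heq.symm measurableSet_Ioo
    · rw [intervalIntegral.integral_of_le hle, integral_Ioc_eq_integral_Ioo,
        setIntegral_congr_fun measurableSet_Ioo heq, setIntegral_const, Real.volume_real_Ioo_of_le hle,
        smul_eq_mul]
      push_cast; ring
  have := intervalIntegral.sum_integral_adjacent_intervals (a := fun j : ℕ => (j * T / k : ℝ)) (n := k)
    (μ := volume) (f := fun x => u ((⌊x * k / T⌋₊ : ℝ) * T / k)) fun j _ => (hpiece j).1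
  simp only [Nat.cast_zero, zero_mul, zero_div] at this
  rw [mul_div_cancel_left₀ _ hk'.ne'] at this
  rw [← this, Finset.mul_sum]
  exact Finset.sum_congr rfl fun j _ => (hpiece j).2

/-! ### Counting functions -/

theorem exists_mesh_increment_le_one {C : ℝ≥0 → ℕ}
    (hjump : ∀ t, ∀ᶠ u in 𝓝 t, C u ≤ C t ∧ C t ≤ C u + 1) (T : ℝ≥0) :
    ∃ δ : ℝ, 0 < δ ∧ ∀ s t : ℝ≥0, s ≤ t → t ≤ T → (t : ℝ) - s < δ → C t ≤ C s + 1 := by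
  choose V hV hVo hVmem using fun t => eventually_nhds_iff.1 (hjump t)
  obtain ⟨δ, hδ, h⟩ := lebesgue_number_lemma_of_metric (s := Set.Icc (0 : ℝ≥0) T) (c := V)
    isCompact_Icc hVo fun t _ => Set.mem_iUnion.2 ⟨t, hVmem t⟩
  refine ⟨δ, hδ, fun s t hst htT hlt => ?_⟩
  obtain ⟨x, hx⟩ := h s ⟨zero_le, hst.trans htT⟩
  have h1 := hV x s (hx (Metric.mem_ball_self hδ))
  have h2 := hV x t (hx (by
    rw [Metric.mem_ball, NNReal.dist_eq, abs_of_nonneg (sub_nonneg.2 (NNReal.coe_le_coe.2 hst))]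
    exact hlt))
  omega

theorem eventually_eq_of_continuousWithinAt_Ici {N : ℝ≥0 → ℕ} {t : ℝ≥0}
    (h : ContinuousWithinAt N (Set.Ici t) t) : ∀ᶠ u in 𝓝[≥] t, N u = N t := by
  have := h.tendsto
  rwa [nhds_discrete, tendsto_pure] at this

theorem eventually_eq_leftLim {N : ℝ≥0 → ℕ} (h : Monotone N) (t : ℝ≥0) :
    ∀ᶠ u in 𝓝[<] t, N u = Function.leftLim N t := by
  have := h.tendsto_leftLim t
  rwa [nhds_discrete, tendsto_pure] at this

theorem jump_add_leftLim {N : ℝ≥0 → ℕ} (h : Monotone N) (t : ℝ≥0) :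
    jump N t + Function.leftLim N t = N t :=
  Nat.sub_add_cancel (h.leftLim_le le_rfl)

/-- The epochs of a right-continuous counting function are attained. -/
theorem jumpEpoch_spec {N : ℝ≥0 → ℕ} (hmono : Monotone N)
    (hrc : ∀ t, ContinuousWithinAt N (Set.Ici t) t) {l : ℕ} {s t : ℝ≥0} (hs : N s ≤ l)
    (ht : l + 1 ≤ N t) :
    s ≤ jumpEpoch N l ∧ jumpEpoch N l ≤ t ∧ l + 1 ≤ N (jumpEpoch N l) := by
  have hne : {t : ℝ≥0 | l + 1 ≤ N t}.Nonempty := ⟨t, ht⟩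
  refine ⟨?_, csInf_le' ht, ?_⟩
  · refine le_csInf hne fun u hu => ?_
    by_contra! hlt
    have := hmono hlt.le
    simp only [Set.mem_ofPred_eq] at hu
    omega
  · by_contra! hlt
    have h1 := eventually_eq_of_continuousWithinAt_Ici (hrc (jumpEpoch N l))
    obtain ⟨v, hv, hsub⟩ := (mem_nhdsGE_iff_exists_Ico_subset' (a := jumpEpoch N l)
      (lt_add_one _)).1 h1
    obtain ⟨u, hu, huv⟩ := exists_lt_of_csInf_lt hne (show sInf _ < v from hv)
    have h2 : N u = N (jumpEpoch N l) := hsub ⟨csInf_le' hu, huv⟩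
    simp only [Set.mem_ofPred_eq] at hu
    omega

variable {m : ℕ}

/-- The monomial `z ^ x`. -/
noncomputable def monomial (z : Fin m → ℝ) (x : Fin m → ℕ) : ℝ := ∏ i, z i ^ x i

theorem abs_monomial_le_one {z : Fin m → ℝ} (hz : ∀ i, |z i| ≤ 1) (x : Fin m → ℕ) :
    |monomial z x| ≤ 1 := by
  rw [monomial, Finset.abs_prod]
  exact Finset.prod_le_one (fun _ _ => abs_nonneg _) fun i _ => by
    rw [abs_pow]; exact pow_le_one₀ (abs_nonneg _) (hz i)

theorem monomial_add (z : Fin m → ℝ) (x y : Fin m → ℕ) :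
    monomial z (x + y) = monomial z x * monomial z y := by
  simp [monomial, pow_add, Finset.prod_mul_distrib]

theorem monomial_single (z : Fin m → ℝ) (i : Fin m) : monomial z (Pi.single i 1) = z i := by
  rw [monomial, Finset.prod_eq_single i]
  · simp
  · intro j _ hj; simp [hj]
  · simp

theorem monotone_toNNReal : Monotone Real.toNNReal := fun _ _ h => Real.toNNReal_mono h

/-- The sample paths of a facility: `K` counts the batches and `N` the departures. -/
structure IsPath (τ : ℕ → ℝ≥0) (g : ℕ → Fin m → ℕ) (K : ℝ≥0 → ℕ) (x : ℝ≥0 → Fin m → ℕ)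
    (N : Fin m → ℝ≥0 → ℕ) : Prop where
  strict : StrictMono τ
  pos : ∀ n, 0 < τ n
  count : ∀ t n, n < K t ↔ τ n ≤ t
  zero : ∀ i, N i 0 = 0
  mono : ∀ i, Monotone (N i)
  right_cont : ∀ i t, ContinuousWithinAt (N i) (Set.Ici t) t
  balance : ∀ t i, x t i + N i t = x 0 i + ∑ n ∈ Finset.range (K t), g n i
  single : ∀ t, ∑ i, jump (N i) t ≤ 1
  no_coincidence : ∀ n i, jump (N i) (τ n) = 0

namespace IsPath

variable {τ : ℕ → ℝ≥0} {g : ℕ → Fin m → ℕ} {K : ℝ≥0 → ℕ} {x : ℝ≥0 → Fin m → ℕ}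
  {N : Fin m → ℝ≥0 → ℕ}

theorem monotone_count (h : IsPath τ g K x N) : Monotone K := fun s t hst => by
  by_contra! hlt
  exact absurd ((h.count t _).2 (((h.count s _).1 hlt).trans hst)) (lt_irrefl _)

theorem count_right (h : IsPath τ g K x N) (t : ℝ≥0) : ∀ᶠ u in 𝓝[≥] t, K u = K t := by
  have hlt : t < τ (K t) := by
    by_contra! hle
    exact absurd ((h.count t _).2 hle) (lt_irrefl _)
  filter_upwards [Ico_mem_nhdsGE hlt] with u hu
  refine le_antisymm ?_ (h.monotone_count hu.1)
  by_contra! hlt'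
  exact absurd ((h.count u _).1 hlt') (not_le.2 hu.2)

theorem count_left (h : IsPath τ g K x N) (t : ℝ≥0) :
    ∀ᶠ u in 𝓝[<] t, K t ≤ K u + 1 ∧ (K t ≠ K u → ∃ n, τ n = t) := by
  have hev : ∀ s < t, ∀ᶠ u in 𝓝[<] t, s ≤ u ∧ u < t := fun s hs => by
    filter_upwards [Ico_mem_nhdsLT hs] with u hu using hu
  obtain hq | ⟨p, hp⟩ : K t = 0 ∨ ∃ p, K t = p + 1 := by
    rcases K t with _ | p
    · exact Or.inl rfl
    · exact Or.inr ⟨p, rfl⟩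
  · filter_upwards [self_mem_nhdsWithin] with u hu
    have := h.monotone_count (le_of_lt hu)
    exact ⟨by omega, fun hne => by omega⟩
  · have hle : τ p ≤ t := (h.count t p).1 (by omega)
    rcases hle.lt_or_eq with hlt | heq
    · filter_upwards [hev _ hlt] with u hu
      have h1 := (h.count u p).2 hu.1
      have h2 := h.monotone_count hu.2.le
      exact ⟨by omega, fun hne => by omega⟩
    · rcases p with _ | r
      · exact Eventually.of_forall fun u => ⟨by omega, fun _ => ⟨_, heq⟩⟩
      · have hlt : τ r < t := heq ▸ h.strict (Nat.lt_succ_self r)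
        filter_upwards [hev _ hlt] with u hu
        have h1 := (h.count u r).2 hu.1
        exact ⟨by omega, fun _ => ⟨_, heq⟩⟩

theorem eventually_events (h : IsPath τ g K x N) (t : ℝ≥0) :
    ∀ᶠ u in 𝓝 t, K u + ∑ i, N i u ≤ K t + ∑ i, N i t ∧
      K t + ∑ i, N i t ≤ K u + ∑ i, N i u + 1 := by
  rw [← nhdsLT_sup_nhdsGE, eventually_sup]
  constructor
  · have h1 : ∀ᶠ u in 𝓝[<] t, ∀ i, N i u = Function.leftLim (N i) t :=
      eventually_all.2 fun i => eventually_eq_leftLim (h.mono i) t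
    filter_upwards [h1, h.count_left t, self_mem_nhdsWithin] with u hu hK hut
    have hut' : u ≤ t := le_of_lt hut
    refine ⟨add_le_add (h.monotone_count hut') (Finset.sum_le_sum fun i _ => h.mono i hut'), ?_⟩
    have hsum : ∑ i, N i t = ∑ i, jump (N i) t + ∑ i, N i u := by
      rw [← Finset.sum_add_distrib]
      exact Finset.sum_congr rfl fun i _ => by rw [hu i, jump_add_leftLim (h.mono i)]
    by_cases hne : K t = K u
    · have := h.single t
      omega
    · obtain ⟨n, hn⟩ := hK.2 hne
      have : ∑ i, jump (N i) t = 0 := Finset.sum_eq_zero fun i _ => hn ▸ h.no_coincidence n i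
      omega
  · have h1 : ∀ᶠ u in 𝓝[≥] t, ∀ i, N i u = N i t :=
      eventually_all.2 fun i => eventually_eq_of_continuousWithinAt_Ici (h.right_cont i t)
    filter_upwards [h1, h.count_right t] with u hu hK
    simp [hu, hK]

theorem state_congr (h : IsPath τ g K x N) {s t : ℝ≥0} (hK : K s = K t)
    (hN : ∀ i, N i s = N i t) : x s = x t := by
  funext i
  have h1 := h.balance s i
  have h2 := h.balance t i
  rw [hK, hN i] at h1
  omega

/-- The total of `z ^ x` over the states left behind by the class-`i` departures up to time `t`. -/
noncomputable def departureSum (z : Fin m → ℝ) (x : ℝ≥0 → Fin m → ℕ) (N : ℝ≥0 → ℕ) (t : ℝ≥0) : ℝ :=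
  ∑ l ∈ Finset.range (N t), monomial z (x (jumpEpoch N l))

/-- The change of `z ^ x` over an interval that contains at most one event. -/
theorem monomial_sub_monomial (h : IsPath τ g K x N) (z : Fin m → ℝ) {s t : ℝ≥0} (hst : s ≤ t)
    (hC : K t + ∑ i, N i t ≤ K s + ∑ i, N i s + 1) :
    monomial z (x t) - monomial z (x s) =
      monomial z (x s) * ∑ n ∈ Finset.Ico (K s) (K t), (monomial z (g n) - 1) +
        ∑ i, (1 - z i) * (departureSum z x (N i) t - departureSum z x (N i) s) := by
  have hKm := h.monotone_count hst
  have hNm : ∀ i, N i s ≤ N i t := fun i => h.mono i hst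
  by_cases hN : ∀ i, N i s = N i t
  · have hD : ∑ i, (1 - z i) * (departureSum z x (N i) t - departureSum z x (N i) s) = 0 :=
      Finset.sum_eq_zero fun i _ => by simp [departureSum, hN i]
    rw [hD, add_zero]
    simp only [hN] at hC
    obtain hK | hK : K t = K s ∨ K t = K s + 1 := by omega
    · rw [h.state_congr hK.symm hN, hK]; simp
    · have hx : x t = x s + g (K s) := by
        funext i
        have h1 := h.balance s i
        have h2 := h.balance t i
        rw [hK, Finset.sum_range_succ] at h2
        rw [hN i] at h1
        simp only [Pi.add_apply]
        omega
      rw [hK, hx, monomial_add]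
      simp; ring
  · push Not at hN
    obtain ⟨i, hi⟩ := hN
    have h1 : N i s + 1 ≤ N i t := by have := hNm i; omega
    have h2 : ∑ j ∈ Finset.univ.erase i, N j s ≤ ∑ j ∈ Finset.univ.erase i, N j t :=
      Finset.sum_le_sum fun j _ => hNm j
    rw [← Finset.add_sum_erase _ _ (Finset.mem_univ i),
      ← Finset.add_sum_erase _ (fun j => N j s) (Finset.mem_univ i)] at hC
    have hK : K t = K s := by omega
    have hi' : N i t = N i s + 1 := by omega
    have hj : ∀ j, j ≠ i → N j t = N j s := by
      have h3 : ∑ j ∈ Finset.univ.erase i, N j s = ∑ j ∈ Finset.univ.erase i, N j t := by omega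
      intro j hj
      exact ((Finset.sum_eq_sum_iff_of_le fun j _ => hNm j).1 h3 j (by simp [hj])).symm
    have hx : x s = x t + Pi.single i 1 := by
      funext j
      have h1 := h.balance s j
      have h2 := h.balance t j
      rw [hK] at h2
      by_cases hji : j = i
      · subst hji; simp only [Pi.add_apply, Pi.single_eq_same]; omega
      · have := hj j hji
        simp only [Pi.add_apply, Pi.single_eq_of_ne hji]; omega
    obtain ⟨e1, e2, e3⟩ := jumpEpoch_spec (h.mono i) (h.right_cont i) le_rfl h1
    have hxe : x (jumpEpoch (N i) (N i s)) = x t := by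
      refine h.state_congr (le_antisymm (h.monotone_count e2) (hK ▸ h.monotone_count e1)) fun j => ?_
      by_cases hji : j = i
      · subst hji; exact le_antisymm (h.mono j e2) (by omega)
      · exact le_antisymm (h.mono j e2) (hj j hji ▸ h.mono j e1)
    rw [Finset.sum_eq_single i, hK, hx, monomial_add, monomial_single, departureSum, departureSum,
      hi', Finset.sum_range_succ, hxe]
    · simp; ring
    · intro j _ hji; simp [departureSum, hj j hji]
    · simp

/-- On a fine mesh the evolution of `z ^ x` is a discrete stochastic integral with respect to the
arrivals plus a sum over the departures. -/
theorem eventually_mesh_identity (h : IsPath τ g K x N) (z : Fin m → ℝ) (T : ℝ≥0) :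
    ∀ᶠ k : ℕ in atTop, monomial z (x T) - monomial z (x 0) =
      ∑ j ∈ Finset.range k, monomial z (x (j * T / k)) *
          ∑ n ∈ Finset.Ico (K (j * T / k)) (K ((j + 1 : ℕ) * T / k)), (monomial z (g n) - 1) +
        ∑ i, (1 - z i) * departureSum z x (N i) T := by
  obtain ⟨δ, hδ, hmesh⟩ := exists_mesh_increment_le_one h.eventually_events T
  filter_upwards [(tendsto_const_div_atTop_nhds_zero_nat (T : ℝ)).eventually (gt_mem_nhds hδ),
    eventually_gt_atTop 0] with k hk hk0
  have hk' : (0 : ℝ≥0) < k := by exact_mod_cast hk0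
  have hstep : ∀ j ∈ Finset.range k,
      monomial z (x ((j + 1 : ℕ) * T / k)) - monomial z (x (j * T / k)) =
      monomial z (x (j * T / k)) *
          ∑ n ∈ Finset.Ico (K (j * T / k)) (K ((j + 1 : ℕ) * T / k)), (monomial z (g n) - 1) +
        ∑ i, (1 - z i) * (departureSum z x (N i) ((j + 1 : ℕ) * T / k) -
          departureSum z x (N i) (j * T / k)) := by
    intro j hj
    have hle : (j * T / k : ℝ≥0) ≤ (j + 1 : ℕ) * T / k := by
      gcongr; exact Nat.le_succ j
    refine h.monomial_sub_monomial z hle (hmesh _ _ hle ?_ ?_)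
    · rw [div_le_iff₀ hk', mul_comm]
      gcongr
      exact Nat.succ_le_of_lt (Finset.mem_range.1 hj)
    · push_cast
      refine lt_of_eq_of_lt ?_ hk
      ring
  have h1 := Finset.sum_congr rfl hstep
  rw [Finset.sum_range_sub (fun j : ℕ => monomial z (x (j * T / k))), Finset.sum_add_distrib,
    Finset.sum_comm] at h1
  simp only [← Finset.mul_sum, Nat.cast_zero, zero_mul, zero_div] at h1
  rw [mul_div_cancel_left₀ _ hk'.ne'] at h1
  rw [h1]
  refine congrArg₂ _ rfl (Finset.sum_congr rfl fun i _ => ?_)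
  rw [Finset.sum_range_sub (fun j : ℕ => departureSum z x (N i) (j * T / k)),
    mul_div_cancel_left₀ _ hk'.ne']
  simp [departureSum, h.zero]

theorem measurable_state (h : IsPath τ g K x N) : Measurable fun s : ℝ => x s.toNNReal := by
  refine measurable_pi_iff.2 fun i => ?_
  have e : (fun s : ℝ => x s.toNNReal i) = fun s : ℝ =>
      (x 0 i + ∑ n ∈ Finset.range (K s.toNNReal), g n i) - N i s.toNNReal := by
    funext s
    have := h.balance s.toNNReal i
    omega
  rw [e]
  have hK : Measurable fun s : ℝ => K s.toNNReal :=
    (h.monotone_count.comp monotone_toNNReal).measurable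
  have hN : Measurable fun s : ℝ => N i s.toNNReal := ((h.mono i).comp monotone_toNNReal).measurable
  exact ((measurable_from_nat (f := fun k => x 0 i + ∑ n ∈ Finset.range k, g n i)).comp hK).sub hN

theorem ae_continuousAt_state (h : IsPath τ g K x N) (f : (Fin m → ℕ) → ℝ) :
    ∀ᵐ s : ℝ, ContinuousAt (fun s : ℝ => f (x s.toNNReal)) s := by
  have key : ∀ C : ℝ≥0 → ℕ, Monotone C →
      ∀ᵐ s : ℝ, ∀ᶠ u in 𝓝 s, C u.toNNReal = C s.toNNReal := fun C hC => by
    have := (hC.comp monotone_toNNReal).countable_not_continuousAt.ae_notMem volume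
    filter_upwards [this] with s hs
    have h1 : ContinuousAt (C ∘ Real.toNNReal) s := by simpa using hs
    have h2 : Tendsto (fun u : ℝ => C u.toNNReal) (𝓝 s) (𝓝 (C s.toNNReal)) := h1.tendsto
    rwa [nhds_discrete ℕ, tendsto_pure] at h2
  filter_upwards [key K h.monotone_count, ae_all_iff.2 fun i => key (N i) (h.mono i)] with s hK hN
  refine ContinuousAt.congr (f := fun _ => f (x s.toNNReal)) continuousAt_const ?_
  filter_upwards [hK, eventually_all.2 hN] with u h1 h2
  rw [h.state_congr h1 h2]

end IsPath

/-! ### Long-run averages along a path -/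

theorem tendsto_sequence_average {E : Type*} [DecidableEq E] [Countable E] [MeasurableSpace E]
    [MeasurableSingletonClass E] (p : PMF E) (y : ℕ → E)
    (h : ∀ x, Tendsto (fun n : ℕ => (n : ℝ)⁻¹ * ∑ l ∈ Finset.range n, if y l = x then (1 : ℝ) else 0)
      atTop (𝓝 (p x).toReal)) {f : E → ℝ} (hf : ∀ x, |f x| ≤ 1) :
    Tendsto (fun n : ℕ => (n : ℝ)⁻¹ * ∑ l ∈ Finset.range n, f (y l)) atTop
      (𝓝 (∑' x, (p x).toReal * f x)) := by
  set μ : ℕ → Measure E := fun n =>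
    ENNReal.ofReal ((n : ℝ)⁻¹) • ∑ l ∈ Finset.range n, Measure.dirac (y l) with hμ
  have hint : ∀ (F : E → ℝ) (n : ℕ),
      ∫ x, F x ∂μ n = (n : ℝ)⁻¹ * ∑ l ∈ Finset.range n, F (y l) := fun F n => by
    rw [hμ]
    simp only
    rw [integral_smul_measure, integral_finsetSum_measure fun l _ => by
      exact integrable_dirac (by simp), ENNReal.toReal_ofReal (by positivity), smul_eq_mul]
    simp
  have hprob : ∀ᶠ n in atTop, IsProbabilityMeasure (μ n) := by
    filter_upwards [eventually_gt_atTop 0] with n hn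
    have hn' : (0 : ℝ) < n := by exact_mod_cast hn
    constructor
    simp only [hμ, Measure.smul_apply, Measure.finsetSum_apply, measure_univ, smul_eq_mul,
      Finset.sum_const, Finset.card_range, nsmul_eq_mul, mul_one]
    rw [ENNReal.ofReal_inv_of_pos hn', ENNReal.ofReal_natCast]
    exact ENNReal.inv_mul_cancel (by simpa using hn.ne') (by simp)
  have hmain := tendsto_integral_of_tendsto_singleton p μ hprob (fun x => ?_) hf
  · simpa only [hint] using hmain
  · refine (h x).congr fun n => ?_
    rw [← integral_indicator_one (measurableSet_singleton x), hint]
    simp [Set.indicator_apply]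

theorem tendsto_time_average {E : Type*} [DecidableEq E] [Countable E] [MeasurableSpace E]
    [MeasurableSingletonClass E] (p : PMF E) {y : ℝ → E} (hy : Measurable y)
    (h : ∀ x, Tendsto (fun T : ℝ => T⁻¹ * ∫ s in (0 : ℝ)..T, if y s = x then (1 : ℝ) else 0)
      atTop (𝓝 (p x).toReal)) {f : E → ℝ} (hf : ∀ x, |f x| ≤ 1) :
    Tendsto (fun n : ℕ => (n : ℝ)⁻¹ * ∫ s in (0 : ℝ)..n, f (y s)) atTop
      (𝓝 (∑' x, (p x).toReal * f x)) := by
  set μ : ℕ → Measure E := fun n =>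
    (ENNReal.ofReal ((n : ℝ)⁻¹) • volume.restrict (Set.Ioc (0 : ℝ) n)).map y with hμ
  have hint : ∀ (F : E → ℝ) (n : ℕ),
      ∫ x, F x ∂μ n = (n : ℝ)⁻¹ * ∫ s in (0 : ℝ)..n, F (y s) := fun F n => by
    rw [hμ]
    simp only
    rw [integral_map hy.aemeasurable (Measurable.of_discrete).aestronglyMeasurable,
      integral_smul_measure, ENNReal.toReal_ofReal (by positivity), smul_eq_mul,
      intervalIntegral.integral_of_le (by positivity)]
  have hprob : ∀ᶠ n in atTop, IsProbabilityMeasure (μ n) := by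
    filter_upwards [eventually_gt_atTop 0] with n hn
    have hn' : (0 : ℝ) < n := by exact_mod_cast hn
    refine (Measure.isProbabilityMeasure_map_iff hy.aemeasurable).2 ⟨?_⟩
    simp only [Measure.smul_apply, Measure.restrict_apply MeasurableSet.univ, Set.univ_inter,
      Real.volume_Ioc, sub_zero, smul_eq_mul]
    rw [ENNReal.ofReal_inv_of_pos hn']
    exact ENNReal.inv_mul_cancel (by simpa using hn.ne') (by simp)
  have hmain := tendsto_integral_of_tendsto_singleton p μ hprob (fun x => ?_) hf
  · simpa only [hint] using hmain
  · refine ((h x).comp tendsto_natCast_atTop_atTop).congr fun n => ?_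
    rw [← integral_indicator_one (measurableSet_singleton x), hint]
    simp [Set.indicator_apply]

theorem eventually_exists_visit {E : Type*} [DecidableEq E] [Countable E] [MeasurableSpace E]
    [MeasurableSingletonClass E] {y : ℝ → E} (hy : Measurable y) {x : E} {q : ℝ} (hq : 0 < q)
    (h : Tendsto (fun T : ℝ => T⁻¹ * ∫ s in (0 : ℝ)..T, if y s = x then (1 : ℝ) else 0)
      atTop (𝓝 q)) {θ : ℝ} (h0 : 0 < θ) (h1 : θ < 1) :
    ∀ᶠ T : ℝ in atTop, ∃ s, θ * T ≤ s ∧ s ≤ T ∧ y s = x := by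
  have hθ : Tendsto (fun T : ℝ => θ * T) atTop atTop := tendsto_id.const_mul_atTop h0
  have hlt : θ * q < q := by nlinarith
  filter_upwards [((h.comp hθ).const_mul θ).eventually_lt h hlt, eventually_gt_atTop 0] with T hT hT0
  by_contra! hno
  refine hT.ne ?_
  have hmeas : Measurable fun s => if y s = x then (1 : ℝ) else 0 :=
    Measurable.ite (hy (measurableSet_singleton x)) measurable_const measurable_const
  have hii : ∀ a b : ℝ, IntervalIntegrable (fun s => if y s = x then (1 : ℝ) else 0) volume a b :=
    fun a b => (intervalIntegrable_const (c := (1 : ℝ))).mono_fun hmeas.aestronglyMeasurable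
      (ae_of_all _ fun s => by dsimp only; split_ifs <;> simp)
  have hz : ∫ s in (θ * T)..T, (if y s = x then (1 : ℝ) else 0) = 0 := by
    rw [intervalIntegral.integral_congr (g := fun _ => (0 : ℝ))]
    · simp
    · intro s hs
      rw [Set.uIcc_of_le (by nlinarith)] at hs
      simp [hno s hs.1 hs.2]
  simp only [Function.comp_apply]
  rw [← intervalIntegral.integral_add_adjacent_intervals (hii 0 (θ * T)) (hii _ T), hz, add_zero]
  field_simp

namespace IsPath

variable {τ : ℕ → ℝ≥0} {g : ℕ → Fin m → ℕ} {K : ℝ≥0 → ℕ} {x : ℝ≥0 → Fin m → ℕ}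
  {N : Fin m → ℝ≥0 → ℕ}

/-- In steady state the departure rate equals the arrival rate. -/
theorem tendsto_departure_rate (h : IsPath τ g K x N) (p : PMF (Fin m → ℕ))
    (hp : ∀ y, Tendsto
      (fun T : ℝ => T⁻¹ * ∫ s in (0 : ℝ)..T, if x s.toNNReal = y then (1 : ℝ) else 0)
      atTop (𝓝 (p y).toReal)) (i : Fin m) {ρ : ℝ}
    (ha : Tendsto (fun n : ℕ => ((∑ l ∈ Finset.range (K n), g l i : ℕ) : ℝ) / n) atTop (𝓝 ρ)) :
    Tendsto (fun n : ℕ => (N i n : ℝ) / n) atTop (𝓝 ρ) := by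
  refine tendsto_order.2 ⟨fun b hb => ?_, fun b hb => ?_⟩
  · obtain ⟨y, hy⟩ := exists_pos_pmf p
    have hθ1 : ∀ᶠ θ : ℝ in 𝓝[<] 1, b < θ * ρ := by
      have : Tendsto (fun θ : ℝ => θ * ρ) (𝓝[<] 1) (𝓝 ρ) := by
        have h1 : ContinuousAt (fun θ : ℝ => θ * ρ) 1 := by fun_prop
        simpa using h1.tendsto.mono_left (nhdsWithin_le_nhds (s := Set.Iio 1))
      exact this.eventually (lt_mem_nhds hb)
    obtain ⟨θ, hθ, h0, h1⟩ := (hθ1.and (Ioo_mem_nhdsLT (zero_lt_one' ℝ))).exists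
    have hvis := tendsto_natCast_atTop_atTop.eventually
      (eventually_exists_visit h.measurable_state hy (hp y) h0 h1)
    have hfl : Tendsto (fun n : ℕ => ⌊θ * n⌋₊) atTop atTop :=
      tendsto_nat_floor_atTop.comp (tendsto_natCast_atTop_atTop.const_mul_atTop h0)
    have hlim : Tendsto (fun n : ℕ =>
        ((∑ l ∈ Finset.range (K (⌊θ * n⌋₊ : ℕ)), g l i : ℕ) : ℝ) / (⌊θ * n⌋₊ : ℕ) *
          ((⌊θ * n⌋₊ : ℕ) / (n : ℝ)) - (y i : ℝ) / n) atTop (𝓝 (ρ * θ - 0)) :=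
      ((ha.comp hfl).mul ((tendsto_nat_floor_mul_div_atTop h0.le).comp
        tendsto_natCast_atTop_atTop)).sub (tendsto_const_div_atTop_nhds_zero_nat _)
    rw [sub_zero, mul_comm] at hlim
    filter_upwards [hlim.eventually (lt_mem_nhds hθ), hvis, eventually_gt_atTop 0,
      hfl.eventually (eventually_gt_atTop 0)] with n hn hv hn0 hf0
    obtain ⟨s, hs1, hs2, hs3⟩ := hv
    have hs0 : 0 ≤ s := le_trans (by positivity) hs1
    refine hn.trans_le ?_
    have hf0' : ((⌊θ * n⌋₊ : ℕ) : ℝ) ≠ 0 := by exact_mod_cast hf0.ne'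
    rw [div_mul_div_cancel₀ hf0', ← sub_div]
    gcongr
    have e1 := h.balance s.toNNReal i
    rw [hs3] at e1
    have e2 : N i s.toNNReal ≤ N i n := h.mono i (Real.toNNReal_le_iff_le_coe.2 (by simpa using hs2))
    have e3 : K (⌊θ * n⌋₊ : ℕ) ≤ K s.toNNReal := by
      refine h.monotone_count ?_
      rw [← NNReal.coe_le_coe, Real.coe_toNNReal _ hs0]
      exact (Nat.floor_le (by positivity)).trans hs1
    have e4 : ∑ l ∈ Finset.range (K (⌊θ * n⌋₊ : ℕ)), g l i ≤
        ∑ l ∈ Finset.range (K s.toNNReal), g l i :=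
      Finset.sum_le_sum_of_subset (Finset.range_subset_range.2 e3)
    rw [sub_le_iff_le_add]
    exact_mod_cast (by omega :
      ∑ l ∈ Finset.range (K (⌊θ * n⌋₊ : ℕ)), g l i ≤ N i n + y i)
  · have hlim : Tendsto (fun n : ℕ => (x 0 i : ℝ) / n +
        ((∑ l ∈ Finset.range (K n), g l i : ℕ) : ℝ) / n) atTop (𝓝 (0 + ρ)) :=
      (tendsto_const_div_atTop_nhds_zero_nat _).add ha
    rw [zero_add] at hlim
    filter_upwards [hlim.eventually (gt_mem_nhds hb)] with n hn
    refine lt_of_le_of_lt ?_ hn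
    rw [← add_div]
    gcongr
    have := h.balance n i
    exact_mod_cast (by omega : N i n ≤ x 0 i + ∑ l ∈ Finset.range (K n), g l i)

theorem tendsto_departureSum_div {z : Fin m → ℝ} (hz : ∀ i, |z i| ≤ 1) (x : ℝ≥0 → Fin m → ℕ)
    (M : ℝ≥0 → ℕ) {ρ : ℝ} (hM : Tendsto (fun n : ℕ => (M n : ℝ) / n) atTop (𝓝 ρ)) (hρ : 0 ≤ ρ)
    (p : PMF (Fin m → ℕ))
    (hp : 0 < ρ → ∀ y, Tendsto (fun n : ℕ => (n : ℝ)⁻¹ * ∑ l ∈ Finset.range n,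
      if x (jumpEpoch M l) = y then (1 : ℝ) else 0) atTop (𝓝 (p y).toReal)) :
    Tendsto (fun n : ℕ => departureSum z x M n / n) atTop (𝓝 (ρ * pgf p z)) := by
  rcases hρ.eq_or_lt with rfl | hρ
  · rw [zero_mul]
    refine squeeze_zero_norm (fun n => ?_) hM
    rw [norm_div, Real.norm_natCast]
    gcongr
    refine (norm_sum_le_of_le (n := fun _ => (1 : ℝ)) _ fun l _ => abs_monomial_le_one hz _).trans ?_
    simp
  · have hinf : Tendsto (fun n : ℕ => M n) atTop atTop := by
      have h1 : Tendsto (fun n : ℕ => (M n : ℝ) / n * n) atTop atTop :=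
        hM.pos_mul_atTop hρ tendsto_natCast_atTop_atTop
      refine tendsto_natCast_atTop_iff.1 (h1.congr' ?_)
      filter_upwards [eventually_gt_atTop 0] with n hn
      have : (n : ℝ) ≠ 0 := by exact_mod_cast hn.ne'
      field_simp
    have h1 := tendsto_sequence_average p (fun l => x (jumpEpoch M l)) (hp hρ)
      (abs_monomial_le_one hz)
    refine (hM.mul (h1.comp hinf)).congr' ?_
    filter_upwards [hinf.eventually (eventually_gt_atTop 0)] with n hn
    have : (M n : ℝ) ≠ 0 := by exact_mod_cast hn.ne'
    simp only [Function.comp_apply, departureSum]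
    field_simp

/-- The compensated arrival part of the evolution of `z ^ x`; `c` is the rate of the compensator. -/
noncomputable def compensated (z : Fin m → ℝ) (c : ℝ) (x : ℝ≥0 → Fin m → ℕ) (N : Fin m → ℝ≥0 → ℕ)
    (T : ℝ≥0) : ℝ :=
  monomial z (x T) - monomial z (x 0) - ∑ i, (1 - z i) * departureSum z x (N i) T -
    c * ∫ s in (0 : ℝ)..T, monomial z (x s.toNNReal)

theorem tendsto_mesh_transform (h : IsPath τ g K x N) {z : Fin m → ℝ} (hz : ∀ i, |z i| ≤ 1) (c : ℝ)
    {T : ℝ≥0} (hT : 0 < T) :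
    Tendsto (fun k : ℕ => ∑ j ∈ Finset.range k, monomial z (x (j * T / k)) *
      (∑ n ∈ Finset.Ico (K (j * T / k)) (K ((j + 1 : ℕ) * T / k)), (monomial z (g n) - 1) -
        c * (T / k))) atTop (𝓝 (compensated z c x N T)) := by
  have hR := tendsto_riemann_sum (u := fun s => monomial z (x s.toNNReal))
    ((Measurable.of_discrete (f := monomial z)).comp h.measurable_state)
    (fun s => abs_monomial_le_one hz _) (h.ae_continuousAt_state _) (T := T) (by exact_mod_cast hT)
  refine ((hR.const_mul c).const_sub _).congr' ?_
  filter_upwards [h.eventually_mesh_identity z T] with k hk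
  rw [hk]
  have e : ∀ j : ℕ, ((j : ℝ) * (T : ℝ) / k).toNNReal = j * T / k := fun j => by
    rw [← NNReal.coe_inj, Real.coe_toNNReal _ (by positivity)]; simp
  simp only [e, mul_sub, Finset.sum_sub_distrib, ← Finset.sum_mul]
  ring

theorem tendsto_compensated_div (h : IsPath τ g K x N) {z : Fin m → ℝ} (hz : ∀ i, |z i| ≤ 1) (c : ℝ)
    (p : PMF (Fin m → ℕ)) (pd : Fin m → PMF (Fin m → ℕ))
    (hp : ∀ y, Tendsto
      (fun T : ℝ => T⁻¹ * ∫ s in (0 : ℝ)..T, if x s.toNNReal = y then (1 : ℝ) else 0)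
      atTop (𝓝 (p y).toReal)) {ρ : Fin m → ℝ} (hρ : ∀ i, 0 ≤ ρ i)
    (ha : ∀ i, Tendsto (fun n : ℕ => ((∑ l ∈ Finset.range (K n), g l i : ℕ) : ℝ) / n) atTop (𝓝 (ρ i)))
    (hpd : ∀ i, 0 < ρ i → ∀ y, Tendsto (fun n : ℕ => (n : ℝ)⁻¹ * ∑ l ∈ Finset.range n,
      if x (jumpEpoch (N i) l) = y then (1 : ℝ) else 0) atTop (𝓝 (pd i y).toReal)) :
    Tendsto (fun n : ℕ => compensated z c x N n / n) atTop
      (𝓝 (-(∑ i, (1 - z i) * (ρ i * pgf (pd i) z)) - c * pgf p z)) := by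
  have h1 : Tendsto (fun n : ℕ => (monomial z (x n) - monomial z (x 0)) / n) atTop (𝓝 0) := by
    refine squeeze_zero_norm (fun n => ?_) (tendsto_const_div_atTop_nhds_zero_nat (2 : ℝ))
    rw [norm_div, Real.norm_natCast]
    gcongr
    have := norm_sub_le (monomial z (x n)) (monomial z (x 0))
    have a1 : ‖monomial z (x n)‖ ≤ 1 := abs_monomial_le_one hz _
    have a2 : ‖monomial z (x 0)‖ ≤ 1 := abs_monomial_le_one hz _
    linarith
  have h2 : Tendsto (fun n : ℕ => ∑ i, (1 - z i) * (departureSum z x (N i) n / n)) atTop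
      (𝓝 (∑ i, (1 - z i) * (ρ i * pgf (pd i) z))) :=
    tendsto_finsetSum _ fun i _ => (tendsto_departureSum_div hz x (N i)
      (h.tendsto_departure_rate p hp i (ha i)) (hρ i) (pd i) (hpd i)).const_mul _
  have h3 : Tendsto (fun n : ℕ => (n : ℝ)⁻¹ * ∫ s in (0 : ℝ)..n, monomial z (x s.toNNReal)) atTop
      (𝓝 (pgf p z)) :=
    tendsto_time_average p h.measurable_state hp (abs_monomial_le_one hz)
  have h4 := (h1.sub h2).sub (h3.const_mul c)
  rw [zero_sub] at h4
  refine h4.congr fun n => ?_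
  simp only [compensated, sub_div, mul_div_assoc, Finset.sum_div, NNReal.coe_natCast]
  ring

end IsPath

theorem lt_ncard_iff_of_isLowerSet {S : Set ℕ} (hS : IsLowerSet S) (hfin : S.Finite) (n : ℕ) :
    n < S.ncard ↔ n ∈ S := by
  classical
  have hex : ∃ k, k ∉ S := hfin.infinite_compl.nonempty
  have e : S = Set.Iio (Nat.find hex) := by
    ext k
    refine ⟨fun hk => ?_, fun hk => not_not.1 (Nat.find_min hex hk)⟩
    by_contra hge
    exact Nat.find_spec hex (hS (not_lt.1 hge) hk)
  have h2 : S.ncard = Nat.find hex := by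
    conv_lhs => rw [e]
    exact Set.ncard_Iio_nat _
  rw [h2]
  conv_rhs => rw [e]
  rfl

theorem integrable_pmf {E : Type*} [Countable E] [MeasurableSpace E] [MeasurableSingletonClass E]
    (p : PMF E) {f : E → ℝ} (hf : Summable fun x => (p x).toReal * f x) :
    Integrable f p.toMeasure := by
  refine ⟨Measurable.of_discrete.aestronglyMeasurable, ?_⟩
  rw [HasFiniteIntegral, lintegral_countable']
  have h := hf.abs.tsum_ofReal_lt_top
  refine lt_of_eq_of_lt (tsum_congr fun x => ?_) h
  rw [p.toMeasure_apply_singleton x (measurableSet_singleton x), abs_mul,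
    abs_of_nonneg ENNReal.toReal_nonneg, ENNReal.ofReal_mul ENNReal.toReal_nonneg,
    ENNReal.ofReal_toReal (p.apply_ne_top x), mul_comm, Real.enorm_eq_ofReal_abs]

/-- The total weight of the batches that arrive during `(s, t]`, for batch weights `φ`. -/
noncomputable def batchSum {Ω : Type*} (τ : ℕ → Ω → ℝ≥0) (G : ℕ → Ω → Fin m → ℕ)
    (φ : (Fin m → ℕ) → ℝ) (s t : ℝ≥0) (ω : Ω) : ℝ :=
  ∑ n ∈ Finset.Ico (batchesIn τ 0 s ω) (batchesIn τ 0 t ω), φ (G n ω)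

namespace IsBatchPoisson

variable {Ω : Type*} {mΩ : MeasurableSpace Ω} {P : Measure Ω}
  {𝓕 : Filtration ℝ≥0 mΩ} {lam : ℝ≥0} {ν : PMF (Fin m → ℕ)} {τ : ℕ → Ω → ℝ≥0}
  {G : ℕ → Ω → Fin m → ℕ}

theorem ae_count (hA : IsBatchPoisson P 𝓕 lam ν τ G) :
    ∀ᵐ ω ∂P, ∀ t n, n < batchesIn τ 0 t ω ↔ τ n ω ≤ t := by
  filter_upwards [hA.epochs] with ω ⟨hpos, hmono, htop⟩ t n
  have e : {n | 0 < τ n ω ∧ τ n ω ≤ t} = {n | τ n ω ≤ t} := by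
    ext n; simp [hpos n]
  rw [batchesIn, e, lt_ncard_iff_of_isLowerSet]
  · rfl
  · exact fun a b hba ha => (hmono.monotone hba).trans ha
  · obtain ⟨k, hk⟩ := (htop.eventually (eventually_gt_atTop t)).exists
    refine (Set.finite_Iio k).subset fun a ha => ?_
    by_contra hge
    exact absurd (hk.trans_le (hmono.monotone (not_lt.1 hge))) (not_lt.2 ha)

theorem ae_mem_Ico (hA : IsBatchPoisson P 𝓕 lam ν τ G) :
    ∀ᵐ ω ∂P, ∀ s t n, n ∈ Finset.Ico (batchesIn τ 0 s ω) (batchesIn τ 0 t ω) ↔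
      s < τ n ω ∧ τ n ω ≤ t := by
  filter_upwards [hA.ae_count] with ω h s t n
  rw [Finset.mem_Ico, h, ← not_lt, h, not_le]

theorem ae_batchesIn (hA : IsBatchPoisson P 𝓕 lam ν τ G) :
    ∀ᵐ ω ∂P, ∀ s t, (batchesIn τ s t ω : ℝ) = batchSum τ G (fun _ => 1) s t ω := by
  filter_upwards [hA.ae_mem_Ico] with ω h s t
  have e : {n | s < τ n ω ∧ τ n ω ≤ t} =
      (Finset.Ico (batchesIn τ 0 s ω) (batchesIn τ 0 t ω) : Finset ℕ) := by
    ext n; rw [Finset.mem_coe, h]; rfl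
  rw [batchesIn, e, Set.ncard_coe_finset, batchSum]
  simp

theorem ae_batchesOfTypeIn (hA : IsBatchPoisson P 𝓕 lam ν τ G) :
    ∀ᵐ ω ∂P, ∀ s t g, batchesOfTypeIn τ G g s t ω =
      ((Finset.Ico (batchesIn τ 0 s ω) (batchesIn τ 0 t ω)).filter fun n => G n ω = g).card := by
  filter_upwards [hA.ae_mem_Ico] with ω h s t g
  rw [batchesOfTypeIn, ← Set.ncard_coe_finset]
  congr 1
  ext n
  rw [Finset.mem_coe, Finset.mem_filter, h, and_assoc]
  rfl

theorem ae_batchSum_zero (hA : IsBatchPoisson P 𝓕 lam ν τ G) (φ : (Fin m → ℕ) → ℝ) :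
    ∀ᵐ ω ∂P, ∀ s t, s ≤ t → batchSum τ G φ s t ω = batchSum τ G φ 0 t ω - batchSum τ G φ 0 s ω := by
  filter_upwards [hA.ae_count, hA.epochs] with ω h ⟨hpos, _, _⟩ s t hst
  have h0 : batchesIn τ 0 0 ω = 0 := by
    by_contra hne
    exact absurd ((h 0 0).1 (Nat.pos_of_ne_zero hne)) (not_le.2 (hpos 0))
  have hle : batchesIn τ 0 s ω ≤ batchesIn τ 0 t ω := by
    by_contra! hlt
    exact absurd ((h t _).2 (((h s _).1 hlt).trans hst)) (lt_irrefl _)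
  simp only [batchSum, h0, ← Finset.range_eq_Ico]
  exact Finset.sum_Ico_eq_sub _ hle

/-- `batchSum` has a version that depends only on the numbers of batches of each type. -/
theorem exists_measurable_batchSum (hA : IsBatchPoisson P 𝓕 lam ν τ G) (φ : (Fin m → ℕ) → ℝ)
    (s t : ℝ≥0) (𝓖 : MeasurableSpace Ω) (h𝓖 : ∀ g, Measurable[𝓖] (batchesOfTypeIn τ G g s t)) :
    ∃ Y : Ω → ℝ, Measurable[𝓖] Y ∧ batchSum τ G φ s t =ᵐ[P] Y := by
  classical
  set F : ℕ → Finset (Fin m → ℕ) := fun k => Fintype.piFinset fun _ => Finset.range k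
  refine ⟨fun ω => limsup (fun k => ∑ g ∈ F k, φ g * (batchesOfTypeIn τ G g s t ω : ℝ)) atTop,
    Measurable.limsup fun k => Finset.measurable_fun_sum _ fun g _ =>
      (measurable_from_nat.comp (h𝓖 g)).const_mul _, ?_⟩
  filter_upwards [hA.ae_batchesOfTypeIn] with ω h
  refine (Tendsto.limsup_eq (tendsto_const_nhds.congr' ?_)).symm
  set I := Finset.Ico (batchesIn τ 0 s ω) (batchesIn τ 0 t ω) with hI
  have hev : ∀ᶠ k in atTop, ∀ n ∈ I, ∀ i, G n ω i < k :=
    (Filter.eventually_all_finset I).2 fun n _ => eventually_all.2 fun i => eventually_gt_atTop _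
  filter_upwards [hev] with k hk
  have hmaps : ∀ n ∈ I, G n ω ∈ F k := fun n hn =>
    Fintype.mem_piFinset.2 fun i => Finset.mem_range.2 (hk n hn i)
  rw [batchSum, ← Finset.sum_fiberwise_of_maps_to hmaps]
  refine Finset.sum_congr rfl fun g _ => ?_
  rw [h s t g, Finset.sum_congr rfl fun n hn => by rw [(Finset.mem_filter.1 hn).2],
    Finset.sum_const, nsmul_eq_mul, mul_comm]

theorem exists_adapted_batchSum (hA : IsBatchPoisson P 𝓕 lam ν τ G) (φ : (Fin m → ℕ) → ℝ)
    {s t : ℝ≥0} (hst : s ≤ t) : ∃ Y : Ω → ℝ, Measurable[𝓕 t] Y ∧ batchSum τ G φ s t =ᵐ[P] Y := by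
  obtain ⟨Y, hY, eY⟩ := hA.exists_measurable_batchSum φ 0 t (𝓕 t) (hA.adapted t)
  obtain ⟨W, hW, eW⟩ := hA.exists_measurable_batchSum φ 0 s (𝓕 s) (hA.adapted s)
  refine ⟨fun ω => Y ω - W ω, hY.sub (hW.mono (𝓕.mono hst) le_rfl), ?_⟩
  filter_upwards [eY, eW, hA.ae_batchSum_zero φ] with ω h1 h2 h3
  rw [h3 s t hst, h1, h2]

theorem indepFun_batchSum (hA : IsBatchPoisson P 𝓕 lam ν τ G) (φ : (Fin m → ℕ) → ℝ)
    (s t : ℝ≥0) {Y : Ω → ℝ} (hY : Measurable[𝓕 s] Y) : IndepFun Y (batchSum τ G φ s t) P := by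
  obtain ⟨W, hW, eW⟩ := hA.exists_measurable_batchSum φ s t (futureArrivals τ G s) fun g =>
    (comap_measurable _).mono (le_iSup₂_of_le t g le_rfl) le_rfl
  refine IndepFun.congr ?_ (ae_eq_refl _) eW.symm
  rw [IndepFun_iff_Indep]
  exact indep_of_indep_of_le_left (indep_of_indep_of_le_right (hA.indep_past s).symm hW.comap_le)
    hY.comap_le

theorem aemeasurable_batchesIn (hA : IsBatchPoisson P 𝓕 lam ν τ G) {s t : ℝ≥0} (hst : s ≤ t) :
    AEMeasurable (batchesIn τ s t) P :=
  AEMeasurable.of_map_ne_zero (by rw [hA.poisson s t hst]; exact IsProbabilityMeasure.ne_zero _)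

theorem aestronglyMeasurable_batchSum (hA : IsBatchPoisson P 𝓕 lam ν τ G) (φ : (Fin m → ℕ) → ℝ)
    {s t : ℝ≥0} (hst : s ≤ t) : AEStronglyMeasurable (batchSum τ G φ s t) P := by
  obtain ⟨Y, hY, eY⟩ := hA.exists_adapted_batchSum φ hst
  exact ((hY.mono (𝓕.le t) le_rfl).aestronglyMeasurable).congr eY.symm

theorem integrable_batchesIn_sq (hA : IsBatchPoisson P 𝓕 lam ν τ G) {s t : ℝ≥0} (hst : s ≤ t) :
    Integrable (fun ω => (batchesIn τ s t ω : ℝ) ^ 2) P := by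
  have h := integrable_poisson_sq (lam * (t - s))
  rw [← hA.poisson s t hst] at h
  exact h.comp_aemeasurable (hA.aemeasurable_batchesIn hst)

theorem integral_batchesIn_sq (hA : IsBatchPoisson P 𝓕 lam ν τ G) {s t : ℝ≥0} (hst : s ≤ t) :
    ∫ ω, (batchesIn τ s t ω : ℝ) ^ 2 ∂P = lam * (t - s) + (lam * (t - s)) ^ 2 := by
  have h := integral_poisson_sq (lam * (t - s))
  rw [← hA.poisson s t hst, integral_map (hA.aemeasurable_batchesIn hst)
    Measurable.of_discrete.aestronglyMeasurable] at h
  rw [h]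
  push_cast [hst]
  ring

theorem integrable_batchesIn (hA : IsBatchPoisson P 𝓕 lam ν τ G) {s t : ℝ≥0} (hst : s ≤ t) :
    Integrable (fun ω => (batchesIn τ s t ω : ℝ)) P := by
  have h := integrable_poisson_id (lam * (t - s))
  rw [← hA.poisson s t hst] at h
  exact h.comp_aemeasurable (hA.aemeasurable_batchesIn hst)

theorem integral_batchesIn (hA : IsBatchPoisson P 𝓕 lam ν τ G) {s t : ℝ≥0} (hst : s ≤ t) :
    ∫ ω, (batchesIn τ s t ω : ℝ) ∂P = lam * (t - s) := by
  have h := integral_poisson_id (lam * (t - s))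
  rw [← hA.poisson s t hst, integral_map (hA.aemeasurable_batchesIn hst)
    Measurable.of_discrete.aestronglyMeasurable] at h
  rw [h]
  push_cast [hst]
  ring

theorem ae_abs_batchSum_le (hA : IsBatchPoisson P 𝓕 lam ν τ G) {φ : (Fin m → ℕ) → ℝ} {b : ℝ}
    (hφ : ∀ g, |φ g| ≤ b) (s t : ℝ≥0) :
    ∀ᵐ ω ∂P, |batchSum τ G φ s t ω| ≤ b * batchesIn τ s t ω := by
  filter_upwards [hA.ae_batchesIn] with ω h
  rw [h s t, batchSum, batchSum, Finset.mul_sum]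
  refine (Finset.abs_sum_le_sum_abs _ _).trans (Finset.sum_le_sum fun n _ => ?_)
  simpa using hφ _

theorem memLp_batchSum (hA : IsBatchPoisson P 𝓕 lam ν τ G) {φ : (Fin m → ℕ) → ℝ} {b : ℝ}
    (hφ : ∀ g, |φ g| ≤ b) {s t : ℝ≥0} (hst : s ≤ t) : MemLp (batchSum τ G φ s t) 2 P := by
  have h : MemLp (fun ω => b * (batchesIn τ s t ω : ℝ)) 2 P :=
    MemLp.const_mul ((memLp_two_iff_integrable_sq
      (hA.integrable_batchesIn hst).1).2 (hA.integrable_batchesIn_sq hst)) b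
  refine h.of_le (hA.aestronglyMeasurable_batchSum φ hst) ?_
  filter_upwards [hA.ae_abs_batchSum_le hφ s t] with ω hω
  exact hω.trans (le_abs_self _)

theorem integral_batchSum_sq_le (hA : IsBatchPoisson P 𝓕 lam ν τ G) {φ : (Fin m → ℕ) → ℝ} {b : ℝ}
    (hφ : ∀ g, |φ g| ≤ b) {s t : ℝ≥0} (hst : s ≤ t) :
    ∫ ω, batchSum τ G φ s t ω ^ 2 ∂P ≤ b ^ 2 * (lam * (t - s) + (lam * (t - s)) ^ 2) := by
  rw [← hA.integral_batchesIn_sq hst, ← integral_const_mul]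
  refine integral_mono_ae (hA.memLp_batchSum hφ hst).integrable_sq
    ((hA.integrable_batchesIn_sq hst).const_mul _) ?_
  filter_upwards [hA.ae_abs_batchSum_le hφ s t] with ω hω
  rw [← sq_abs, ← mul_pow]
  exact pow_le_pow_left₀ (abs_nonneg _) hω 2

theorem integral_batch (hA : IsBatchPoisson P 𝓕 lam ν τ G) {φ : (Fin m → ℕ) → ℝ}
    (hφ : Summable fun g => (ν g).toReal * φ g) (n : ℕ) :
    Integrable (fun ω => φ (G n ω)) P ∧ ∫ ω, φ (G n ω) ∂P = ∑' g, (ν g).toReal * φ g := by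
  have h1 := integrable_pmf ν hφ
  have h2 := ν.integral_eq_tsum φ h1
  rw [← hA.batch_law n] at h1 h2
  rw [integral_map (hA.measurable_batch n).aemeasurable
    Measurable.of_discrete.aestronglyMeasurable] at h2
  exact ⟨h1.comp_aemeasurable (hA.measurable_batch n).aemeasurable, h2⟩

theorem measurableSet_epoch (hA : IsBatchPoisson P 𝓕 lam ν τ G) (s t : ℝ≥0) (n : ℕ) :
    MeasurableSet {ω | s < τ n ω ∧ τ n ω ≤ t} :=
  hA.measurable_epoch n measurableSet_Ioc

/-! ### Laws of large numbers for the arrivals -/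

theorem ae_tendsto_batchesIn_div (hA : IsBatchPoisson P 𝓕 lam ν τ G) :
    ∀ᵐ ω ∂P, Tendsto (fun n : ℕ => (batchesIn τ 0 n ω : ℝ) / n) atTop (𝓝 lam) := by
  have hle : ∀ n : ℕ, (n : ℝ≥0) ≤ (n + 1 : ℕ) := fun n => by exact_mod_cast n.le_succ
  have hone : ∀ n : ℕ, ((n + 1 : ℕ) : ℝ≥0) - n = 1 := fun n => by
    push_cast; exact add_tsub_cancel_left _ _
  set X : ℕ → Ω → ℝ := fun n ω => (batchesIn τ n (n + 1 : ℕ) ω : ℝ) with hX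
  have hXb : ∀ n : ℕ, X n =ᵐ[P] batchSum τ G (fun _ => 1) n (n + 1 : ℕ) := fun n => by
    filter_upwards [hA.ae_batchesIn] with ω h using h _ _
  have hindep : ∀ i j, i < j → IndepFun (X i) (X j) P := fun i j hij => by
    obtain ⟨Y, hY, eY⟩ := hA.exists_adapted_batchSum (fun _ => 1) (hle i)
    refine (hA.indepFun_batchSum (fun _ => 1) j (j + 1 : ℕ) (hY.mono (𝓕.mono ?_) le_rfl)).congr
      ((hXb i).trans eY).symm (hXb j).symm
    exact_mod_cast hij
  have hlaw := strong_law_ae_real X (hA.integrable_batchesIn (hle 0))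
    (fun i j hij => by
      rcases lt_or_gt_of_ne hij with h | h
      · exact hindep i j h
      · exact (hindep j i h).symm)
    (fun i => by
      have hid : IdentDistrib (batchesIn τ (i : ℕ) (i + 1 : ℕ)) (batchesIn τ (0 : ℕ) (0 + 1 : ℕ)) P P :=
        ⟨hA.aemeasurable_batchesIn (hle i), hA.aemeasurable_batchesIn (hle 0), by
          rw [hA.poisson _ _ (hle i), hA.poisson _ _ (hle 0), hone, hone]⟩
      exact hid.comp (u := fun n : ℕ => (n : ℝ)) Measurable.of_discrete)
  rw [hA.integral_batchesIn (hle 0)] at hlaw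
  filter_upwards [hlaw, hA.ae_batchesIn, hA.ae_batchSum_zero fun _ => 1] with ω h h1 h2
  have e : ∀ n : ℕ, ∑ i ∈ Finset.range n, X i ω = batchesIn τ 0 n ω := fun n => by
    have h3 : ∀ i : ℕ, X i ω = (batchesIn τ 0 (i + 1 : ℕ) ω : ℝ) - batchesIn τ 0 i ω := fun i => by
      rw [h1, h1, ← h2 _ _ (hle i), ← h1]
    rw [Finset.sum_congr rfl fun i _ => h3 i,
      Finset.sum_range_sub fun i : ℕ => (batchesIn τ 0 i ω : ℝ), h1 0 ((0 : ℕ) : ℝ≥0)]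
    simp [batchSum]
  simpa [e] using h

theorem ae_tendsto_arrivals_div (hA : IsBatchPoisson P 𝓕 lam ν τ G) (hlam : 0 < lam) (i : Fin m)
    (hν : HasFiniteMean ν i) :
    ∀ᵐ ω ∂P, Tendsto (fun n : ℕ => ((∑ l ∈ Finset.range (batchesIn τ 0 n ω), G l ω i : ℕ) : ℝ) / n)
      atTop (𝓝 (lam * mean ν i)) := by
  have hm : Measurable fun y : Fin m → ℕ => (y i : ℝ) := Measurable.of_discrete
  have hint := hA.integral_batch (φ := fun y => (y i : ℝ)) hν 0
  have hlaw := strong_law_ae_real (fun n ω => (G n ω i : ℝ)) hint.1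
    (fun a b hab => (hA.batch_indep.indepFun hab).comp hm hm)
    (fun n => by
      have hid : IdentDistrib (G n) (G 0) P P :=
        ⟨(hA.measurable_batch n).aemeasurable, (hA.measurable_batch 0).aemeasurable, by
          rw [hA.batch_law, hA.batch_law]⟩
      exact hid.comp hm)
  rw [hint.2] at hlaw
  filter_upwards [hlaw, hA.ae_tendsto_batchesIn_div] with ω h1 h2
  have hinf : Tendsto (fun n : ℕ => batchesIn τ 0 n ω) atTop atTop := by
    have h3 : Tendsto (fun n : ℕ => (batchesIn τ 0 n ω : ℝ) / n * n) atTop atTop :=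
      h2.pos_mul_atTop (by exact_mod_cast hlam) tendsto_natCast_atTop_atTop
    refine tendsto_natCast_atTop_iff.1 (h3.congr' ?_)
    filter_upwards [eventually_gt_atTop 0] with n hn
    have : (n : ℝ) ≠ 0 := by exact_mod_cast hn.ne'
    field_simp
  refine (h2.mul (h1.comp hinf)).congr' ?_
  filter_upwards [hinf.eventually (eventually_gt_atTop 0)] with n hn
  have : (batchesIn τ 0 n ω : ℝ) ≠ 0 := by exact_mod_cast hn.ne'
  simp only [Function.comp_apply]
  push_cast
  field_simp

/-! ### Moments of the batch sums -/

variable [IsProbabilityMeasure P]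

theorem summable_epoch (hA : IsBatchPoisson P 𝓕 lam ν τ G) {s t : ℝ≥0} (hst : s ≤ t) :
    Summable fun n => P.real {ω | s < τ n ω ∧ τ n ω ≤ t} := by
  refine summable_of_sum_range_le (c := ∫ ω, (batchesIn τ s t ω : ℝ) ∂P)
    (fun _ => measureReal_nonneg) fun N => ?_
  have hi : ∀ n, Integrable ({ω | s < τ n ω ∧ τ n ω ≤ t}.indicator fun _ => (1 : ℝ)) P := fun n =>
    (integrable_const _).indicator (hA.measurableSet_epoch s t n)
  have e : ∀ n, P.real {ω | s < τ n ω ∧ τ n ω ≤ t} =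
      ∫ ω, {ω | s < τ n ω ∧ τ n ω ≤ t}.indicator (fun _ => (1 : ℝ)) ω ∂P := fun n =>
    (integral_indicator_one (hA.measurableSet_epoch s t n)).symm
  simp only [e]
  rw [← integral_finsetSum _ fun n _ => hi n]
  refine integral_mono_ae (integrable_finsetSum _ fun n _ => hi n) (hA.integrable_batchesIn hst) ?_
  filter_upwards [hA.ae_batchesIn, hA.ae_mem_Ico] with ω h1 h2
  rw [h1 s t, batchSum]
  simp only [Set.indicator_apply]
  rw [← Finset.sum_filter]
  refine Finset.sum_le_sum_of_subset_of_nonneg (fun n hn => ?_) fun _ _ _ => zero_le_one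
  exact (h2 s t n).2 (Finset.mem_filter.1 hn).2

theorem hasSum_integral_batchSum (hA : IsBatchPoisson P 𝓕 lam ν τ G) {φ : (Fin m → ℕ) → ℝ} {b : ℝ}
    (hφ : ∀ g, |φ g| ≤ b) (hsum : Summable fun g => (ν g).toReal * φ g) {s t : ℝ≥0} (hst : s ≤ t) :
    HasSum (fun n => P.real {ω | s < τ n ω ∧ τ n ω ≤ t} * ∑' g, (ν g).toReal * φ g)
      (∫ ω, batchSum τ G φ s t ω ∂P) := by
  set E : ℕ → Set Ω := fun n => {ω | s < τ n ω ∧ τ n ω ≤ t} with hE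
  have hb : 0 ≤ b := (abs_nonneg _).trans (hφ 0)
  set f : ℕ → Ω → ℝ := fun n ω => (E n).indicator (fun _ => (1 : ℝ)) ω * φ (G n ω) with hf
  have hEi : ∀ n, Integrable ((E n).indicator fun _ => (1 : ℝ)) P := fun n =>
    (integrable_const _).indicator (hA.measurableSet_epoch s t n)
  have hGm : ∀ n, Measurable fun ω => φ (G n ω) := fun n =>
    Measurable.of_discrete.comp (hA.measurable_batch n)
  have hfi : ∀ n, Integrable (f n) P := fun n =>
    (hEi n).mul_bdd (c := b) (hGm n).aestronglyMeasurable (ae_of_all _ fun ω => hφ _)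
  have hfn : ∀ n, ∫ ω, f n ω ∂P = P.real (E n) * ∑' g, (ν g).toReal * φ g := fun n => by
    have hind : IndepFun ((E n).indicator fun _ => (1 : ℝ)) (fun ω => φ (G n ω)) P := by
      have hm1 : Measurable ({u : ℕ → ℝ≥0 | s < u n ∧ u n ≤ t}.indicator fun _ => (1 : ℝ)) :=
        measurable_const.indicator (measurable_pi_apply (X := fun _ : ℕ => ℝ≥0) n measurableSet_Ioc)
      have hm2 : Measurable fun u : ℕ → Fin m → ℕ => φ (u n) :=
        Measurable.of_discrete.comp (measurable_pi_apply n)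
      exact hA.batch_indep_epochs.symm.comp hm1 hm2
    rw [hind.integral_fun_mul_eq_mul_integral (hEi n).1 (hGm n).aestronglyMeasurable,
      (hA.integral_batch hsum n).2]
    congr 1
    exact integral_indicator_one (hA.measurableSet_epoch s t n)
  have hfs : Summable fun n => ∫ ω, ‖f n ω‖ ∂P := by
    refine Summable.of_nonneg_of_le (fun n => integral_nonneg fun ω => norm_nonneg _) (fun n => ?_)
      ((hA.summable_epoch hst).mul_right b)
    have e : P.real (E n) = ∫ ω, (E n).indicator (fun _ => (1 : ℝ)) ω ∂P :=
      (integral_indicator_one (hA.measurableSet_epoch s t n)).symm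
    rw [e, ← integral_mul_const]
    refine integral_mono (hfi n).norm ((hEi n).mul_const b) fun ω => ?_
    rw [hf]
    simp only [norm_mul]
    have h0 : (0 : ℝ) ≤ (E n).indicator (fun _ => (1 : ℝ)) ω :=
      Set.indicator_nonneg (fun _ _ => zero_le_one) ω
    rw [Real.norm_of_nonneg h0]
    exact mul_le_mul_of_nonneg_left (hφ _) h0
  have h := hasSum_integral_of_summable_integral_norm hfi hfs
  simp only [hfn] at h
  refine (integral_congr_ae ?_ : ∫ ω, batchSum τ G φ s t ω ∂P = ∫ ω, ∑' n, f n ω ∂P) ▸ h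
  filter_upwards [hA.ae_mem_Ico] with ω h2
  rw [batchSum, tsum_eq_sum (s := Finset.Ico (batchesIn τ 0 s ω) (batchesIn τ 0 t ω)) fun n hn => by
    rw [h2] at hn
    simp only [hf]
    rw [Set.indicator_of_notMem (by exact hn), zero_mul]]
  refine Finset.sum_congr rfl fun n hn => ?_
  rw [h2] at hn
  simp only [hf]
  rw [Set.indicator_of_mem (by exact hn), one_mul]

theorem integral_batchSum (hA : IsBatchPoisson P 𝓕 lam ν τ G) {φ : (Fin m → ℕ) → ℝ} {b : ℝ}
    (hφ : ∀ g, |φ g| ≤ b) (hsum : Summable fun g => (ν g).toReal * φ g) {s t : ℝ≥0} (hst : s ≤ t) :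
    ∫ ω, batchSum τ G φ s t ω ∂P = lam * (t - s) * ∑' g, (ν g).toReal * φ g := by
  have h1 := hA.hasSum_integral_batchSum (φ := fun _ => 1) (b := 1) (by simp)
    (by simpa using (hasSum_pmf_toReal ν).summable) hst
  simp only [mul_one, (hasSum_pmf_toReal ν).tsum_eq] at h1
  have e : ∫ ω, batchSum τ G (fun _ => 1) s t ω ∂P = lam * (t - s) := by
    rw [← hA.integral_batchesIn hst]
    refine integral_congr_ae ?_
    filter_upwards [hA.ae_batchesIn] with ω h
    exact (h s t).symm
  rw [e] at h1
  exact (hA.hasSum_integral_batchSum hφ hsum hst).unique (h1.mul_right _)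

end IsBatchPoisson

theorem pgf_eq_tsum_monomial (p : PMF (Fin m → ℕ)) (z : Fin m → ℝ) :
    pgf p z = ∑' y, (p y).toReal * monomial z y := rfl

theorem lintegral_sq_le_of_tendsto {Ω : Type*} {mΩ : MeasurableSpace Ω} {P : Measure Ω}
    {f : ℕ → Ω → ℝ} {F : Ω → ℝ} (hf : ∀ k, AEMeasurable (f k) P)
    (hlim : ∀ᵐ ω ∂P, Tendsto (fun k => f k ω) atTop (𝓝 (F ω))) {C : ℝ≥0∞}
    (hC : ∀ᶠ k in atTop, ∫⁻ ω, ENNReal.ofReal (f k ω ^ 2) ∂P ≤ C) :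
    ∫⁻ ω, ENNReal.ofReal (F ω ^ 2) ∂P ≤ C := by
  have e : ∀ᵐ ω ∂P, ENNReal.ofReal (F ω ^ 2) =
      liminf (fun k => ENNReal.ofReal (f k ω ^ 2)) atTop := by
    filter_upwards [hlim] with ω h
    exact (ENNReal.tendsto_ofReal (h.pow 2)).liminf_eq.symm
  rw [lintegral_congr_ae e]
  refine (lintegral_liminf_le' fun k => ((hf k).pow_const 2).ennreal_ofReal).trans ?_
  exact (liminf_le_liminf hC).trans_eq (liminf_const _)

theorem integral_sub_const_sq_le {Ω : Type*} {mΩ : MeasurableSpace Ω} {P : Measure Ω}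
    [IsProbabilityMeasure P] {B : Ω → ℝ} (hB : MemLp B 2 P) :
    ∫ ω, (B ω - ∫ ω', B ω' ∂P) ^ 2 ∂P ≤ ∫ ω, B ω ^ 2 ∂P := by
  have h := variance_eq_sub hB
  rw [variance_eq_integral hB.1.aemeasurable] at h
  rw [h]
  simp only [Pi.pow_apply]
  linarith [sq_nonneg (∫ ω', B ω' ∂P)]

section

variable {Ω : Type*} {mΩ : MeasurableSpace Ω} {P : Measure Ω}
  {𝓕 : Filtration ℝ≥0 mΩ} {lam : ℝ≥0} {ν : PMF (Fin m → ℕ)} {τ : ℕ → Ω → ℝ≥0}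
  {G : ℕ → Ω → Fin m → ℕ} {X : ℝ≥0 → Ω → Fin m → ℕ} {N : Fin m → ℝ≥0 → Ω → ℕ}

theorem IsFacility.ae_isPath (hX : IsFacility P 𝓕 τ G X N) (hA : IsBatchPoisson P 𝓕 lam ν τ G) :
    ∀ᵐ ω ∂P, IsPath (fun n => τ n ω) (fun n => G n ω) (fun t => batchesIn τ 0 t ω)
      (fun t => X t ω) (fun i t => N i t ω) := by
  filter_upwards [hA.epochs, hA.ae_count, hX.counting, hX.balance, hX.single, hX.no_coincidence]
    with ω h1 h2 h3 h4 h5 h6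
  exact ⟨h1.2.1, h1.1, h2, fun i => (h3 i).1, fun i => (h3 i).2.1, fun i => (h3 i).2.2, h4, h5, h6⟩

/-- The discretized compensated arrival part of the evolution of `z ^ X`, on a mesh of `k` steps. -/
noncomputable def meshTransform (τ : ℕ → Ω → ℝ≥0) (G : ℕ → Ω → Fin m → ℕ) (X : ℝ≥0 → Ω → Fin m → ℕ)
    (z : Fin m → ℝ) (c : ℝ) (T : ℝ≥0) (k : ℕ) (ω : Ω) : ℝ :=
  ∑ j ∈ Finset.range k, monomial z (X (j * T / k) ω) *
    (batchSum τ G (fun g => monomial z g - 1) (j * T / k) ((j + 1 : ℕ) * T / k) ω - c * (T / k))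

variable [IsProbabilityMeasure P]

theorem meshTransform_memLp_and_sq_le (hX : IsFacility P 𝓕 τ G X N)
    (hA : IsBatchPoisson P 𝓕 lam ν τ G) {z : Fin m → ℝ} (hz : ∀ i, |z i| ≤ 1) (T : ℝ≥0) {k : ℕ}
    (hk : 0 < k) :
    MemLp (meshTransform τ G X z (lam * (pgf ν z - 1)) T k) 2 P ∧
      ∫ ω, meshTransform τ G X z (lam * (pgf ν z - 1)) T k ω ^ 2 ∂P ≤
        k * (2 ^ 2 * (lam * (T / k) + (lam * (T / k)) ^ 2)) := by
  have hle : ∀ j : ℕ, (j * T / k : ℝ≥0) ≤ (j + 1 : ℕ) * T / k := fun j => by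
    gcongr; exact Nat.le_succ j
  have hlen : ∀ j : ℕ, (((j + 1 : ℕ) * T / k : ℝ≥0) : ℝ) - ((j * T / k : ℝ≥0) : ℝ) = T / k :=
    fun j => by push_cast; ring
  have hφ : ∀ g, |monomial z g - 1| ≤ 2 := fun g => by
    have := abs_le.1 (abs_monomial_le_one hz g)
    exact abs_le.2 ⟨by linarith, by linarith⟩
  have h1 := summable_pmf_mul ν (abs_monomial_le_one hz)
  have h2 := hasSum_pmf_toReal ν
  have hsum : Summable fun g => (ν g).toReal * (monomial z g - 1) := by
    simpa only [mul_sub, mul_one] using h1.sub h2.summable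
  have hval : ∑' g, (ν g).toReal * (monomial z g - 1) = pgf ν z - 1 := by
    simp only [mul_sub, mul_one]
    rw [h1.tsum_sub h2.summable, h2.tsum_eq, pgf_eq_tsum_monomial]
  have hL := fun j : ℕ => hA.memLp_batchSum hφ (hle j)
  have hmean : ∀ j : ℕ, ∫ ω, batchSum τ G (fun g => monomial z g - 1) (j * T / k)
      ((j + 1 : ℕ) * T / k) ω ∂P = lam * (pgf ν z - 1) * (T / k) := fun j => by
    rw [hA.integral_batchSum hφ hsum (hle j), hval, hlen]; ring
  obtain ⟨r1, r2, -⟩ := integral_sq_transform_le (P := P) (fun j : ℕ => 𝓕 (j * T / k))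
    (fun i j hij => 𝓕.mono (by gcongr)) (fun j => 𝓕.le _)
    (fun j ω => monomial z (X (j * T / k) ω))
    (fun j ω => batchSum τ G (fun g => monomial z g - 1) (j * T / k) ((j + 1 : ℕ) * T / k) ω -
      lam * (pgf ν z - 1) * (T / k))
    (fun j => (Measurable.of_discrete (f := monomial z)).comp (hX.adapted _))
    (fun j ω => abs_monomial_le_one hz _)
    (fun j => by
      obtain ⟨Y, hY, eY⟩ := hA.exists_adapted_batchSum (fun g => monomial z g - 1) (hle j)
      refine ⟨fun ω => Y ω - lam * (pgf ν z - 1) * (T / k), hY.sub_const _, ?_⟩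
      filter_upwards [eY] with ω h
      rw [h])
    (fun j Y hY => (hA.indepFun_batchSum _ _ _ hY).comp measurable_id
      (measurable_id.sub_const (lam * (pgf ν z - 1) * (T / k) : ℝ)))
    (fun j => (hL j).sub (memLp_const _))
    (fun j => by
      rw [integral_sub ((hL j).integrable (by norm_num)) (integrable_const _), hmean]
      simp)
    (v := 2 ^ 2 * (lam * (T / k) + (lam * (T / k)) ^ 2))
    (fun j => by
      have h3 := integral_sub_const_sq_le (hL j)
      rw [hmean] at h3
      refine h3.trans ((hA.integral_batchSum_sq_le hφ (hle j)).trans_eq ?_)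
      rw [hlen]) k
  exact ⟨r1, r2⟩

theorem lintegral_compensated_sq_le (hX : IsFacility P 𝓕 τ G X N)
    (hA : IsBatchPoisson P 𝓕 lam ν τ G) {z : Fin m → ℝ} (hz : ∀ i, |z i| ≤ 1) {n : ℕ} (hn : 0 < n) :
    AEMeasurable (fun ω => IsPath.compensated z (lam * (pgf ν z - 1)) (fun t => X t ω)
      (fun i t => N i t ω) n) P ∧
    ∫⁻ ω, ENNReal.ofReal (IsPath.compensated z (lam * (pgf ν z - 1)) (fun t => X t ω)
      (fun i t => N i t ω) n ^ 2) ∂P ≤ ENNReal.ofReal (4 * (lam + lam ^ 2) * n) := by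
  have hn' : (0 : ℝ≥0) < n := by exact_mod_cast hn
  set f : ℕ → Ω → ℝ := fun k => meshTransform τ G X z (lam * (pgf ν z - 1)) n (k + 1) with hf
  have hmem := fun k : ℕ => meshTransform_memLp_and_sq_le hX hA hz n k.succ_pos
  have hm : ∀ k, AEMeasurable (f k) P := fun k => (hmem k).1.1.aemeasurable
  have hlim : ∀ᵐ ω ∂P, Tendsto (fun k => f k ω) atTop
      (𝓝 (IsPath.compensated z (lam * (pgf ν z - 1)) (fun t => X t ω) (fun i t => N i t ω) n)) := by
    filter_upwards [hX.ae_isPath hA] with ω h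
    exact (h.tendsto_mesh_transform hz (lam * (pgf ν z - 1)) hn').comp (tendsto_add_atTop_nat 1)
  refine ⟨aemeasurable_of_tendsto_metrizable_ae' hm hlim, lintegral_sq_le_of_tendsto hm hlim ?_⟩
  filter_upwards [eventually_ge_atTop n] with k hk
  rw [← ofReal_integral_eq_lintegral_ofReal (hmem k).1.integrable_sq
    (ae_of_all _ fun ω => sq_nonneg _)]
  refine ENNReal.ofReal_le_ofReal ((hmem k).2.trans ?_)
  have hk0 : (0 : ℝ) < (k + 1 : ℕ) := by positivity
  have hnk : (n : ℝ) / (k + 1 : ℕ) ≤ 1 := by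
    rw [div_le_one hk0]; exact_mod_cast hk.trans k.le_succ
  have hl : (0 : ℝ) ≤ (lam : ℝ) ^ 2 * n := by positivity
  have e : ((k + 1 : ℕ) : ℝ) * (2 ^ 2 * (lam * ((n : ℝ) / (k + 1 : ℕ)) +
      (lam * ((n : ℝ) / (k + 1 : ℕ))) ^ 2)) =
      4 * (lam * n + (lam : ℝ) ^ 2 * n * ((n : ℝ) / (k + 1 : ℕ))) := by
    field_simp
    ring
  rw [NNReal.coe_natCast, e]
  nlinarith [mul_le_mul_of_nonneg_left hnk hl]

/-- The compensated arrival part of the evolution of `z ^ X` vanishes in the long run. -/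
theorem eq_zero_of_tendsto_compensated_div (hX : IsFacility P 𝓕 τ G X N)
    (hA : IsBatchPoisson P 𝓕 lam ν τ G) {z : Fin m → ℝ} (hz : ∀ i, |z i| ≤ 1) {a : ℝ}
    (ha : ∀ᵐ ω ∂P, Tendsto (fun n : ℕ => IsPath.compensated z (lam * (pgf ν z - 1)) (fun t => X t ω)
      (fun i t => N i t ω) n / n) atTop (𝓝 a)) : a = 0 := by
  set M : ℕ → Ω → ℝ := fun n ω => IsPath.compensated z (lam * (pgf ν z - 1)) (fun t => X t ω)
      (fun i t => N i t ω) n with hM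
  have hb : ∀ n : ℕ, 0 < n →
      ∫⁻ ω, ENNReal.ofReal ((M n ω / n) ^ 2) ∂P ≤ ENNReal.ofReal (4 * (lam + lam ^ 2) / n) := by
    intro n hn
    have hn' : (0 : ℝ) < n := by exact_mod_cast hn
    have e : ∀ ω, ENNReal.ofReal ((M n ω / n) ^ 2) =
        ENNReal.ofReal (((n : ℝ) ^ 2)⁻¹) * ENNReal.ofReal (M n ω ^ 2) := fun ω => by
      rw [← ENNReal.ofReal_mul (by positivity), div_pow, div_eq_inv_mul]
    simp only [e]
    rw [lintegral_const_mul' _ _ ENNReal.ofReal_ne_top]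
    refine (mul_le_mul_right (lintegral_compensated_sq_le hX hA hz hn).2 _).trans_eq ?_
    rw [← ENNReal.ofReal_mul (by positivity)]
    congr 1
    field_simp
  have hsq : ∀ ε : ℝ, 0 < ε → a ^ 2 ≤ ε := by
    intro ε hε
    have h := lintegral_sq_le_of_tendsto (P := P) (f := fun n ω => M (n + 1) ω / (n + 1 : ℕ))
      (F := fun _ => a) (C := ENNReal.ofReal ε)
      (fun n => (lintegral_compensated_sq_le hX hA hz n.succ_pos).1.div_const _)
      (by filter_upwards [ha] with ω h using h.comp (tendsto_add_atTop_nat 1)) (by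
        filter_upwards [((tendsto_const_div_atTop_nhds_zero_nat (4 * ((lam : ℝ) + lam ^ 2))).comp
          (tendsto_add_atTop_nat 1)).eventually (gt_mem_nhds hε)] with n hn
        exact (hb (n + 1) n.succ_pos).trans (ENNReal.ofReal_le_ofReal hn.le))
    simpa [ENNReal.ofReal_le_ofReal_iff hε.le] using h
  exact pow_eq_zero_iff two_ne_zero |>.1 (le_antisymm (le_of_forall_pos_le_add fun ε hε => by
    simpa using hsq ε hε) (sq_nonneg a))

end

end BatchQueue

theorem mainTheorem2 {Ω : Type*} {mΩ : MeasurableSpace Ω} (P : Measure Ω) [IsProbabilityMeasure P]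
    (𝓕 : Filtration ℝ≥0 mΩ) {m : ℕ}
    -- a batch Poisson arrival process with rate `lam` and batch distribution `ν`
    (lam : ℝ≥0) (hlam : 0 < lam) (ν : PMF (Fin m → ℕ)) (hν : ∀ i, BatchQueue.HasFiniteMean ν i)
    (τ : ℕ → Ω → ℝ≥0) (G : ℕ → Ω → Fin m → ℕ)
    (hA : BatchQueue.IsBatchPoisson P 𝓕 lam ν τ G)
    -- the service facility
    (X : ℝ≥0 → Ω → Fin m → ℕ) (N : Fin m → ℝ≥0 → Ω → ℕ)
    (hX : BatchQueue.IsFacility P 𝓕 τ G X N)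
    -- the steady-state distributions at an arbitrary time and after class-`i` departures
    (π : PMF (Fin m → ℕ)) (hπ : BatchQueue.IsSteadyState P X π)
    (πd : Fin m → PMF (Fin m → ℕ))
    (hπd : ∀ i, 0 < BatchQueue.mean ν i → BatchQueue.IsSteadyStateAfterJumps P X (N i) (πd i))
    (z : Fin m → ℝ) (hz : ∀ i, |z i| ≤ 1) :
    (1 - BatchQueue.pgf ν z) * BatchQueue.pgf π z =
      ∑ i, (1 - z i) * BatchQueue.mean ν i * BatchQueue.pgf (πd i) z := by
  have hmean : ∀ i, 0 ≤ BatchQueue.mean ν i := fun i =>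
    tsum_nonneg fun y => mul_nonneg ENNReal.toReal_nonneg (Nat.cast_nonneg _)
  have hlam' : (0 : ℝ) < lam := by exact_mod_cast hlam
  have harr := ae_all_iff.2 fun i => hA.ae_tendsto_arrivals_div hlam i (hν i)
  have hdep : ∀ᵐ ω ∂P, ∀ i, 0 < BatchQueue.mean ν i → ∀ y : Fin m → ℕ,
      Tendsto (fun n : ℕ => (n : ℝ)⁻¹ * ∑ l ∈ Finset.range n,
        if X (BatchQueue.jumpEpoch (fun u => N i u ω) l) ω = y then (1 : ℝ) else 0)
        atTop (𝓝 (πd i y).toReal) := by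
    refine ae_all_iff.2 fun i => ?_
    by_cases h : 0 < BatchQueue.mean ν i
    · filter_upwards [hπd i h] with ω hω _ using hω
    · exact ae_of_all _ fun ω h' => absurd h' h
  have hlim := BatchQueue.eq_zero_of_tendsto_compensated_div hX hA hz
    (a := -(∑ i, (1 - z i) * (lam * BatchQueue.mean ν i * BatchQueue.pgf (πd i) z)) -
      lam * (BatchQueue.pgf ν z - 1) * BatchQueue.pgf π z) (by
    filter_upwards [hX.ae_isPath hA, harr, hdep, hπ] with ω h h1 h2 h3
    exact h.tendsto_compensated_div hz _ π πd h3 (fun i => mul_nonneg hlam'.le (hmean i)) h1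
      fun i hi => h2 i (pos_of_mul_pos_right hi hlam'.le))
  have e : ∑ i, (1 - z i) * (lam * BatchQueue.mean ν i * BatchQueue.pgf (πd i) z) =
      lam * ∑ i, (1 - z i) * BatchQueue.mean ν i * BatchQueue.pgf (πd i) z := by
    rw [Finset.mul_sum]
    exact Finset.sum_congr rfl fun i _ => by ring
  rw [e] at hlim
  refine mul_left_cancel₀ hlam'.ne' ?_
  linarith
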